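/- **Terms.** The ordinal terms $\mathrm{OT}$ and the distinguished subset $\mathbb H\subseteq\mathrm{OT}$ are generated as follows: if $\{\alpha_0,\dots,\alpha_{k-1}\}$ is a finite multiset of elements of $\mathbb H$ with $k\ne 1$, then $\#\{\alpha_0,\dots,\alpha_{k-1}\}\in\mathrm{OT}$; if $\alpha\in\mathrm{OT}$ then $\omega^\alpha\in\mathbb H$ and $\vartheta\alpha\in\mathbb H$; for each integer $J\le 0$, $\Omega^{(J)}\in\mathbb H$. Let $\mathbb{SC}$ be the set of elements of $\mathbb H$ not of the form $\omega^\alpha$. **Formal cardinality.** For integers $J$: $\mathrm{FC}^{\le J}(\#\{\alpha_i\})=\bigcup_i\mathrm{FC}^{\le J}(\alpha_i)$; $\mathrm{FC}^{\le J}(\omega^\alpha)=\mathrm{FC}^{\le J}(\alpha)$; $\mathrm{FC}^{\le J}(\Omega^{(J')})$ is $\{J'-J\}$ if $J'\le J$ and $\emptyset$ otherwise; $\mathrm{FC}^{\le J}(\vartheta\alpha)=\mathrm{FC}^{\le J-1}(\alpha)$. Put $\mathrm{FC}=\mathrm{FC}^{\le 0}$, $\overline{\mathrm{FC}}(\alpha)=\max\mathrm{FC}(\alpha)$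 and $G(\alpha)=\min\mathrm{FC}(\alpha)$ (the *ground* of $\alpha$), both being $-\infty$ if $\mathrm{FC}(\alpha)=\emptyset$. **Shifting.** For an integer $k$, $\alpha^{\le J}_{+k}$ is defined by $\#\{\alpha_i\}^{\le J}_{+k}=\#\{(\alpha_i)^{\le J}_{+k}\}$; $(\omega^\alpha)^{\le J}_{+k}=\omega^{\alpha^{\le J}_{+k}}$; $(\Omega^{(J')})^{\le J}_{+k}$ is $\Omega^{(J'+k)}$ if $J'\le J$ and $\Omega^{(J')}$ otherwise; $(\vartheta\alpha)^{\le J}_{+k}=\vartheta(\alpha^{\le J-1}_{+k})$. (It is only used below where no positive level arises.) **Critical subterms.** $K^{<J}\#\{\alpha_i\}=\bigcup_iK^{<J}\alpha_i$; $K^{<J}\omega^\alpha=K^{<J}\alpha$; $K^{<J}\Omega^{(J')}$ is $\{\Omega^{(J'-(J-1))}\}$ if $J'<J$ and $\emptyset$ otherwise; $K^{<J}\vartheta\alpha$ is $\{(\vartheta\alpha)^{\le 0}_{+(1-J)}\}$ if $\overline{\mathrm{FC}}(\vartheta\alpha)<J$ and $K^{<J-1}\alpha$ otherwise. **Order.**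 The relation $<$ on terms is defined recursively by the following clauses ($\le$ means $<$ or $=$, $\setminus$ is the difference of multisets, and $\#\{\dots\}$ denotes a sum whose number of summands is not $1$). - $\#\{\alpha_i\}<\#\{\beta_j\}$ if some $b\in\{\beta_j\}\setminus\{\alpha_i\}$ satisfies $a<b$ for all $a\in\{\alpha_i\}\setminus\{\beta_j\}$. - For $\beta\in\mathbb H$: $\beta<\#\{\alpha_i\}$ if $\beta\le\alpha_i$ for some $i$; $\#\{\alpha_i\}<\beta$ if $\alpha_i<\beta$ for all $i$. - $\omega^\alpha<\omega^\beta$ if $\alpha<\beta$. - For $\beta\in\mathbb{SC}$: $\beta<\omega^\alpha$ if $\beta\le\alpha$; $\omega^\alpha<\beta$ if $\alpha<\beta$. - $\Omega^{(J)}<\Omega^{(J')}$ if $J<J'$. - $\Omega^{(J)}<\vartheta\alpha$ if $\Omega^{(J)}\le\beta$ for some $\beta\in K^{<0}\alpha$; $\vartheta\alpha<\Omega^{(J)}$ if $\beta<\Omega^{(J)}$ for all $\beta\in K^{<0}\alpha$. - $\vartheta\alpha<\vartheta\beta$ if either $\alpha<\beta$ and $\gamma<\vartheta\beta$ for all $\gamma\in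 K^{<0}\alpha$, or $\beta<\alpha$ and $\vartheta\alpha\le\gamma$ for some $\gamma\in K^{<0}\beta$. **Normalization and the sets $M_n$, $\mathrm{Acc}_n$.** Put $\alpha^*=\alpha$ if $\overline{\mathrm{FC}}(\alpha)=-\infty$ and $\alpha^*=\alpha^{\le 0}_{+(-\overline{\mathrm{FC}}(\alpha))}$ otherwise. For $n\in\{-\infty\}\cup\mathbb N$ define recursively: $M_{-\infty}=\{\alpha:\overline{\mathrm{FC}}(\alpha)=-\infty\}$; for $n\in\mathbb N$, $M_n$ is the set of terms $\alpha$ with $\overline{\mathrm{FC}}(\alpha)=0$, $G(\alpha)\ge -n$ and $\{\beta^*:\beta\in K^{<0}\alpha\}\subseteq\bigcup_{i<n}\mathrm{Acc}_i$ (where $i$ ranges over $\{-\infty\}\cup\mathbb N$); and $\mathrm{Acc}_n$ is the well-founded part of $M_n$ with respect to $<$ restricted to $M_n$. **Comparison from the ground.** For terms $\alpha,\beta$ let $g(\alpha)=G(\alpha)$ if $G(\alpha)\ne-\infty$ and $g(\alpha)=0$ otherwise (in which case shifting does not change $\alpha$), and let $m=\min(g(\alpha),g(\beta))$. Write $\alpha\prec\beta$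 if $\alpha^{\le 0}_{+(m-g(\alpha))}<\beta^{\le 0}_{+(m-g(\beta))}$, that is, if $\alpha$ is less than $\beta$ once both have been shifted down to share the same ground. **Theorem.** Let $\alpha$ be an ordinal term. 1. If $G(\alpha^*)=-\infty$, then $\alpha^*\in\mathrm{Acc}_{-\infty}$. 2. If $G(\alpha^*)\neq-\infty$, then $\alpha^*\in\mathrm{Acc}_n$ for every $n\in\mathbb N$ with $n\ge -G(\alpha^*)$. Moreover, $\prec$ is well-founded on the set $\{\alpha^*:\alpha\in\mathrm{OT}\}$ of normalized terms. -/

import Mathlib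

namespace PolyOT

/-- The admissible levels of `Ω`: the integers `J ≤ 0`. -/
abbrev Level : Type := {J : ℤ // J ≤ 0}

/-! ### Terms

Every ordinal term is either an element of the distinguished set `H`, or a formal sum `#{h₀, …}`
of a finite multiset of elements of `H` whose number of summands is not one. Identifying `h ∈ H`
with the multiset `{h}`, the ordinal terms are exactly the finite multisets of elements of `H`
(`0` is the empty sum), and `H` is freely generated from them by `α ↦ ω^α`, `J ↦ Ω^(J)` and
`α ↦ ϑα`. So `H` is the initial algebra of the functor `Node` below. -/

/-- One layer of a term in `H`, over a type `X` of immediate principal subterms. -/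
inductive Node (X : Type) : Type
  | omega (s : Multiset X) : Node X
  | Omega (J : Level) : Node X
  | theta (s : Multiset X) : Node X

/-- The action of a map on a layer. -/
def Node.map {X Y : Type} (f : X → Y) : Node X → Node Y
  | .omega s => .omega (s.map f)
  | .Omega J => .Omega J
  | .theta s => .theta (s.map f)

/-- Shapes of a layer: the constructor and the number of summands of its argument. -/
inductive Shape : Type
  | omega (n : ℕ) : Shape
  | Omega (J : Level) : Shape
  | theta (n : ℕ) : Shape

/-- The number of immediate principal subterms of a layer of a given shape. -/
def Shape.arity : Shape → ℕ
  | .omega n => n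
  | .Omega _ => 0
  | .theta n => n

/-- The layer with a given shape and a given enumeration of its subterms. -/
def Node.ofShape {X : Type} : (a : Shape) → (Fin a.arity → X) → Node X
  | .omega _, f => .omega (List.ofFn f : Multiset X)
  | .Omega J, _ => .Omega J
  | .theta _, f => .theta (List.ofFn f : Multiset X)

theorem Node.ofShape_surjective {X : Type} (x : Node X) :
    ∃ p : (a : Shape) × (Fin a.arity → X), Node.ofShape p.1 p.2 = x := by
  cases x with
  | omega s =>
    refine ⟨⟨.omega s.toList.length, s.toList.get⟩, ?_⟩
    simp [Node.ofShape, List.ofFn_get, Shape.arity]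
  | Omega J => exact ⟨⟨.Omega J, Fin.elim0⟩, rfl⟩
  | theta s =>
    refine ⟨⟨.theta s.toList.length, s.toList.get⟩, ?_⟩
    simp [Node.ofShape, List.ofFn_get, Shape.arity]

theorem Node.map_ofShape {X Y : Type} (f : X → Y) (a : Shape) (g : Fin a.arity → X) :
    Node.ofShape a (f ∘ g) = (Node.ofShape a g).map f := by
  cases a <;> simp [Node.ofShape, Node.map, List.map_ofFn]

/-- `Node` is a quotient of a polynomial functor, so that its initial algebra exists. -/
noncomputable instance : QPF Node where
  map := Node.map
  P := ⟨Shape, fun a => Fin a.arity⟩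
  abs p := Node.ofShape p.1 p.2
  repr x := (Node.ofShape_surjective x).choose
  abs_repr x := (Node.ofShape_surjective x).choose_spec
  abs_map f p := Node.map_ofShape f p.1 p.2

/-- The set `ℍ` of additively principal terms: the initial algebra of `Node`. -/
def H : Type := QPF.Fix Node

/-- Ordinal terms. The multiset `{h₀, …, hₙ₋₁}` stands for `#{h₀, …, hₙ₋₁}` if `n ≠ 1`, and for
`h₀` itself if `n = 1`. (The order of terms is `Lt` below, not the inclusion of multisets.) -/
abbrev OT : Type := Multiset H

noncomputable instance : DecidableEq H := Classical.decEq H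

/-- `ω^α` -/
noncomputable def omega (α : OT) : H := QPF.Fix.mk (Node.omega α)

/-- `Ω^(J)` -/
noncomputable def Omega (J : Level) : H := QPF.Fix.mk (Node.Omega J)

/-- `ϑα` -/
noncomputable def theta (α : OT) : H := QPF.Fix.mk (Node.theta α)

/-- The recursor of `H`: a function out of `H` given by its values on `ω^α`, `Ω^(J)`, `ϑα` in
terms of the multiset of its values on the summands of `α`. -/
noncomputable def H.fold {X : Type} (g : Node X → X) : H → X := QPF.Fix.rec g

theorem H.fold_omega {X : Type} (g : Node X → X) (α : OT) :
    H.fold g (omega α) = g (.omega (α.map (H.fold g))) := QPF.Fix.rec_eq g _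

theorem H.fold_Omega {X : Type} (g : Node X → X) (J : Level) :
    H.fold g (Omega J) = g (.Omega J) := QPF.Fix.rec_eq g _

theorem H.fold_theta {X : Type} (g : Node X → X) (α : OT) :
    H.fold g (theta α) = g (.theta (α.map (H.fold g))) := QPF.Fix.rec_eq g _

/-- Structural induction on `H`. -/
theorem H.ind {p : H → Prop} (homega : ∀ α : OT, (∀ h ∈ α, p h) → p (omega α))
    (hOmega : ∀ J, p (Omega J)) (htheta : ∀ α : OT, (∀ h ∈ α, p h) → p (theta α)) (h : H) :
    p h := by
  refine QPF.Fix.ind (F := Node) p ?_ h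
  rintro x ⟨u, rfl⟩
  cases u with
  | omega s =>
    refine homega (s.map Subtype.val) ?_
    intro a ha
    obtain ⟨b, -, rfl⟩ := Multiset.mem_map.1 ha
    exact b.2
  | Omega J => exact hOmega J
  | theta s =>
    refine htheta (s.map Subtype.val) ?_
    intro a ha
    obtain ⟨b, -, rfl⟩ := Multiset.mem_map.1 ha
    exact b.2

/-- The constructors are injective and have disjoint ranges: `H` is freely generated. -/
theorem H.mk_injective : Function.Injective (QPF.Fix.mk : Node H → H) := fun x y hxy => by
  rw [← QPF.Fix.dest_mk x, ← QPF.Fix.dest_mk y, hxy]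

/-- The set `𝕊ℂ`: the elements of `ℍ` not of the form `ω^α`. -/
def H.IsSC (h : H) : Prop := ∀ α : OT, h ≠ omega α

/-! ### Formal cardinalities -/

/-- `FC^{≤ J}` of an element of `H`; see the four clauses following `FC`. -/
noncomputable def H.FC (h : H) : ℤ → Finset ℤ :=
  H.fold (X := ℤ → Finset ℤ)
    (fun
      | .omega s => fun J => (s.map fun f => f J).sup
      | .Omega J' => fun J => if J'.1 ≤ J then {J'.1 - J} else ∅
      | .theta s => fun J => (s.map fun f => f (J - 1)).sup) h

/-- `FC^{≤ J}(α)`, the union over the summands of `α`. -/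
noncomputable def FC (J : ℤ) (α : OT) : Finset ℤ := (α.map fun h => h.FC J).sup

theorem FC_sum (J : ℤ) (α : OT) : FC J α = (α.map fun h => FC J {h}).sup := by simp [FC]

theorem FC_omega (J : ℤ) (α : OT) : FC J {omega α} = FC J α := by
  simp [FC, H.FC, H.fold_omega, Multiset.map_map]

theorem FC_Omega (J : ℤ) (J' : Level) :
    FC J {Omega J'} = if J'.1 ≤ J then {J'.1 - J} else ∅ := by
  simp [FC, H.FC, H.fold_Omega]

theorem FC_theta (J : ℤ) (α : OT) : FC J {theta α} = FC (J - 1) α := by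
  simp [FC, H.FC, H.fold_theta, Multiset.map_map]

/-- The formal cardinality of `α`: the maximum of `FC^{≤ 0}(α)`, and `-∞` (that is, `⊥`) if this
set is empty. -/
noncomputable def FCbar (α : OT) : WithBot ℤ := (FC 0 α).max

/-- The ground of `α`: the minimum of `FC^{≤ 0}(α)`, and `-∞` if this set is empty. -/
noncomputable def ground (α : OT) : WithBot ℤ :=
  if h : (FC 0 α).Nonempty then (((FC 0 α).min' h : ℤ) : WithBot ℤ) else ⊥

/-! ### Shifting -/

/-- `z` itself when `z ≤ 0`. (A shift to a positive level is meaningless; it never occurs in the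
definitions of `K`, `star` and `GroundLt` below.) -/
def Level.clip (z : ℤ) : Level := ⟨min z 0, min_le_right z 0⟩

/-- Shifting an element of `H`; see the four clauses following `shift`. -/
noncomputable def H.shift (h : H) : ℤ → ℤ → H :=
  H.fold (X := ℤ → ℤ → H)
    (fun
      | .omega s => fun J n => PolyOT.omega (s.map fun f => f J n)
      | .Omega J' => fun J n =>
          if J'.1 ≤ J then PolyOT.Omega (Level.clip (J'.1 + n)) else PolyOT.Omega J'
      | .theta s => fun J n => PolyOT.theta (s.map fun f => f (J - 1) n)) h

/-- `α^{≤ J}_{+n}`, for an integer `n` of any sign. -/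
noncomputable def shift (J n : ℤ) (α : OT) : OT := α.map fun h => h.shift J n

theorem shift_sum (J n : ℤ) (α : OT) : shift J n α = (α.map fun h => shift J n {h}).sum := by
  conv_lhs => rw [← Multiset.sum_map_singleton (shift J n α)]
  simp [shift, Multiset.map_map]

theorem shift_omega (J n : ℤ) (α : OT) : shift J n {omega α} = {omega (shift J n α)} := by
  simp [shift, H.shift, H.fold_omega, Multiset.map_map]

theorem shift_Omega (J n : ℤ) (J' : Level) :
    shift J n {Omega J'} = if J'.1 ≤ J then {Omega (Level.clip (J'.1 + n))} else {Omega J'} := by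
  simp only [shift, H.shift, H.fold_Omega, Multiset.map_singleton]
  split_ifs <;> rfl

theorem shift_theta (J n : ℤ) (α : OT) : shift J n {theta α} = {theta (shift (J - 1) n α)} := by
  simp [shift, H.shift, H.fold_theta, Multiset.map_map]

/-! ### Critical subterms -/

/-- Simultaneous recursion for an element of `H` (first component) and its sets `K^{< J}` (second
component); see the four clauses following `K`. -/
noncomputable def H.withK (h : H) : H × (ℤ → Set OT) :=
  H.fold (X := H × (ℤ → Set OT))
    (fun
      | .omega s => (PolyOT.omega (s.map Prod.fst), fun J => {γ | ∃ p ∈ s, γ ∈ p.2 J})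
      | .Omega J' => (PolyOT.Omega J', fun J =>
          if h : J'.1 < J then {{PolyOT.Omega ⟨J'.1 - (J - 1), by omega⟩}} else ∅)
      | .theta s => (PolyOT.theta (s.map Prod.fst), fun J =>
          if FCbar {PolyOT.theta (s.map Prod.fst)} < (J : WithBot ℤ) then
            {PolyOT.shift 0 (1 - J) {PolyOT.theta (s.map Prod.fst)}}
          else {γ | ∃ p ∈ s, γ ∈ p.2 (J - 1)})) h

/-- `K^{< J} α`, the set of critical subterms of `α`: the union over the summands of `α`. -/
noncomputable def K (J : ℤ) (α : OT) : Set OT := {γ | ∃ h ∈ α, γ ∈ h.withK.2 J}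

theorem H.withK_fst (h : H) : h.withK.1 = h := by
  induction h using H.ind with
  | homega α ih =>
    have e : α.map (fun x => x.withK.1) = α := by
      conv_rhs => rw [← Multiset.map_id α]
      exact Multiset.map_congr rfl ih
    simp only [H.withK, H.fold_omega, Multiset.map_map]
    exact congrArg PolyOT.omega e
  | hOmega J => simp [H.withK, H.fold_Omega]
  | htheta α ih =>
    have e : α.map (fun x => x.withK.1) = α := by
      conv_rhs => rw [← Multiset.map_id α]
      exact Multiset.map_congr rfl ih
    simp only [H.withK, H.fold_theta, Multiset.map_map]
    exact congrArg PolyOT.theta e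

theorem K_sum (J : ℤ) (α : OT) : K J α = ⋃ h ∈ α, K J {h} := by
  ext γ; simp [K]

theorem K_omega (J : ℤ) (α : OT) : K J {PolyOT.omega α} = K J α := by
  have e : (omega α).withK.2 J = {γ | ∃ p ∈ α.map H.withK, γ ∈ p.2 J} := by
    have := H.fold_omega (X := H × (ℤ → Set OT))
    conv_lhs => rw [H.withK, this]
    rfl
  ext γ
  simp only [K, Multiset.mem_singleton, exists_eq_left, Set.mem_ofPred_eq]
  rw [e]
  simp

theorem K_Omega (J : ℤ) (J' : Level) :
    K J {PolyOT.Omega J'} =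
      if h : J'.1 < J then {{PolyOT.Omega ⟨J'.1 - (J - 1), by omega⟩}} else ∅ := by
  ext γ; simp [K, H.withK, H.fold_Omega]

theorem K_theta (J : ℤ) (α : OT) :
    K J {theta α} =
      if FCbar {theta α} < (J : WithBot ℤ) then {shift 0 (1 - J) {theta α}} else K (J - 1) α := by
  have e : (α.map H.withK).map Prod.fst = α := by
    rw [Multiset.map_map]
    conv_rhs => rw [← Multiset.map_id α]
    exact Multiset.map_congr rfl fun x _ => H.withK_fst x
  have e2 : (theta α).withK.2 J =
      if FCbar {theta α} < (J : WithBot ℤ) then {shift 0 (1 - J) {theta α}} else K (J - 1) α := by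
    have := H.fold_theta (X := H × (ℤ → Set OT))
    conv_lhs => rw [H.withK, this]
    change (if FCbar {theta ((α.map H.withK).map Prod.fst)} < (J : WithBot ℤ) then
      {shift 0 (1 - J) {theta ((α.map H.withK).map Prod.fst)}}
      else {γ | ∃ p ∈ α.map H.withK, γ ∈ p.2 (J - 1)}) = _
    rw [e]
    congr 1
    ext γ; simp [K]
  ext γ
  simp only [K, Multiset.mem_singleton, exists_eq_left, Set.mem_ofPred_eq]
  rw [e2]
  rfl

/-! ### The order -/

/-- The order of ordinal terms, as the least relation closed under its defining clauses (every
clause refers to smaller pairs of terms only, so this is also the recursively defined relation).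
A premise `x ≠ y → Lt x y` expresses `x ≤ y`, that is, `x = y` or `Lt x y`. In `sum_sum`, `-` is the difference of multisets. -/
inductive Lt : OT → OT → Prop
  | sum_sum {α β : OT} {b : H} (hα : Multiset.card α ≠ 1) (hβ : Multiset.card β ≠ 1)
      (hb : b ∈ β - α) (h : ∀ a ∈ α - β, Lt {a} {b}) : Lt α β
  | prin_sum {b a : H} {α : OT} (hα : Multiset.card α ≠ 1) (ha : a ∈ α)
      (h : b ≠ a → Lt {b} {a}) : Lt {b} α
  | sum_prin {α : OT} {b : H} (hα : Multiset.card α ≠ 1) (h : ∀ a ∈ α, Lt {a} {b}) : Lt α {b}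
  | omega_omega {α β : OT} (h : Lt α β) : Lt {omega α} {omega β}
  | sc_omega {b : H} {α : OT} (hb : b.IsSC) (h : {b} ≠ α → Lt {b} α) : Lt {b} {omega α}
  | omega_sc {α : OT} {b : H} (hb : b.IsSC) (h : Lt α {b}) : Lt {omega α} {b}
  | Omega_Omega {J J' : Level} (h : J.1 < J'.1) : Lt {Omega J} {Omega J'}
  | Omega_theta {J : Level} {α β : OT} (hβ : β ∈ K 0 α) (h : {Omega J} ≠ β → Lt {Omega J} β) :
      Lt {Omega J} {theta α}
  | theta_Omega {α : OT} {J : Level} (h : ∀ β ∈ K 0 α, Lt β {Omega J}) : Lt {theta α} {Omega J}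
  | theta_theta_of_lt {α β : OT} (hlt : Lt α β) (h : ∀ γ ∈ K 0 α, Lt γ {theta β}) :
      Lt {theta α} {theta β}
  | theta_theta_of_gt {α β γ : OT} (hgt : Lt β α) (hγ : γ ∈ K 0 β)
      (h : {theta α} ≠ γ → Lt {theta α} γ) : Lt {theta α} {theta β}

/-! ### Normalization, and the sets `M_n` and `Acc_n` -/

/-- `α*`: the free levels of `α` shifted up so that the largest one is `0`. -/
noncomputable def star (α : OT) : OT :=
  if FCbar α = ⊥ then α else shift 0 (-(FCbar α).unbotD 0) α

/-- The well-founded part of a set `S` of terms, with respect to the order restricted to `S`. -/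
def wfPart (S : Set OT) : Set OT := {α ∈ S | Acc (fun β γ => β ∈ S ∧ γ ∈ S ∧ Lt β γ) α}

/-- The sets `M_n` for `n ∈ {-∞} ∪ ℕ`, with `-∞` written `⊥`. -/
noncomputable def M : WithBot ℕ → Set OT
  | ⊥ => {α | FCbar α = ⊥}
  | (n : ℕ) => {α | FCbar α = 0 ∧ ((-(n : ℤ) : ℤ) : WithBot ℤ) ≤ ground α ∧
      ∀ β ∈ K 0 α, ∃ i : WithBot ℕ, ∃ _ : i < (n : WithBot ℕ), star β ∈ wfPart (M i)}
termination_by n => n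

/-- `Acc_n`, the well-founded part of `M_n`. -/
noncomputable def AccSet (n : WithBot ℕ) : Set OT := wfPart (M n)

theorem M_bot : M ⊥ = {α | FCbar α = ⊥} := by
  rw [M.eq_def]

theorem M_coe (n : ℕ) :
    M (n : WithBot ℕ) = {α | FCbar α = 0 ∧ ((-(n : ℤ) : ℤ) : WithBot ℤ) ≤ ground α ∧
      star '' K 0 α ⊆ ⋃ i < (n : WithBot ℕ), AccSet i} := by
  rw [M.eq_def]
  ext α
  simp [AccSet, Set.subset_def]

/-- The ground of `α` as an integer, with value `0` for terms without free levels (on which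
shifting has no effect). -/
noncomputable def groundInt (α : OT) : ℤ := (ground α).unbotD 0

/-- Comparison of terms from their ground: `α` and `β` are shifted down so as to have the same
ground, namely the smaller of their two grounds, and are then compared. -/
def GroundLt (α β : OT) : Prop :=
  Lt (shift 0 (min (groundInt α) (groundInt β) - groundInt α) α)
    (shift 0 (min (groundInt α) (groundInt β) - groundInt β) β)

end PolyOT

namespace PolyOT

/-! ### Induction on terms -/

/-! The core is that `Lt` is well-founded on the terms whose free levels are bounded below. `Stage
m` collects terms with levels in `(-m, 0]`, where for `m = k + 1` all critical subterms (`K 0`) must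
be accessible in `Stage k`; "accessible" means lying in the well-founded part of the stage.
Accessibility is closed under sums (multiset order) and `ω`. Moreover: * lowering all levels by one
carries accessible terms of stage `m` to stage `m + 1` (`shift_mem_Acc`). Hence a strongly critical
term of stage `m + 1` with only negative levels is accessible: its sole critical subterm is its own
shift up by one (`mem_Acc_of_level_neg`); * `ϑ` collapses stage `m + 1` into stage `m`
(`theta_mem_Acc`), the usual impredicative step.

Induction on size, and inside it on the stage, makes every term with levels above `-m` accessible in
`Stage m` (`mem_Acc`). These arguments rest on `Lt` respecting the largest level (`Lt.level_le`), on
shifts preserving `Lt` (`Lt.shift`), and on the behaviour of `K` under shifts and iteration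
(`K_shift_image`, `K_shift_eq`, `K_pred`).

Consequently each `Acc_n` is all of `M_n`, and only membership in `M_n` remains. This follows by
induction on `n`, since passing to critical subterms raises the ground by at least one and
normalizing never lowers it. For comparison from the ground, a predecessor of a normalized term has
ground at least as large when it is itself normalized, so a whole descending sequence can be shifted
to one common ground, where `Lt` is well-founded. -/

theorem term_induction {P : OT → Prop} (hsum : ∀ α : OT, (∀ h ∈ α, P {h}) → P α)
    (homega : ∀ α, P α → P {omega α}) (hOmega : ∀ J, P {Omega J})
    (htheta : ∀ α, P α → P {theta α}) (α : OT) : P α :=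
  hsum α fun h _ => H.ind (p := fun h => P {h}) (fun α ih => homega α (hsum α ih)) hOmega
    (fun α ih => htheta α (hsum α ih)) h

theorem omega_inj {α β : OT} : omega α = omega β ↔ α = β :=
  ⟨fun h => Node.omega.inj (H.mk_injective h), fun h => h ▸ rfl⟩

theorem theta_inj {α β : OT} : theta α = theta β ↔ α = β :=
  ⟨fun h => Node.theta.inj (H.mk_injective h), fun h => h ▸ rfl⟩

theorem Omega_inj {I J : Level} : Omega I = Omega J ↔ I = J :=
  ⟨fun h => by simpa using H.mk_injective h, fun h => h ▸ rfl⟩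

theorem omega_ne_Omega {α : OT} {J : Level} : omega α ≠ Omega J :=
  fun h => by simpa using H.mk_injective h

theorem omega_ne_theta {α β : OT} : omega α ≠ theta β :=
  fun h => by simpa using H.mk_injective h

theorem Omega_ne_theta {J : Level} {β : OT} : Omega J ≠ theta β :=
  fun h => by simpa using H.mk_injective h

theorem isSC_Omega (J : Level) : (Omega J).IsSC := fun _ h => omega_ne_Omega h.symm

theorem isSC_theta (α : OT) : (theta α).IsSC := fun _ h => omega_ne_theta h.symm

theorem not_isSC_omega (α : OT) : ¬ (omega α).IsSC := fun h => h α rfl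

theorem H.cases_on (h : H) :
    (∃ α, h = omega α) ∨ (∃ J, h = Omega J) ∨ ∃ α, h = theta α := by
  induction h using H.ind with
  | homega α => exact .inl ⟨α, rfl⟩
  | hOmega J => exact .inr (.inl ⟨J, rfl⟩)
  | htheta α => exact .inr (.inr ⟨α, rfl⟩)

/-! ### Size -/

/-- The number of constructors of a principal term. -/
noncomputable def H.size (h : H) : ℕ :=
  H.fold (X := ℕ) (fun
    | .omega s => s.sum + 1
    | .Omega _ => 1
    | .theta s => s.sum + 1) h

/-- The total number of constructors of the summands of a term. -/
noncomputable def size (α : OT) : ℕ := (α.map H.size).sum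

theorem size_singleton (h : H) : size {h} = h.size := by simp [size]

theorem size_omega (α : OT) : (omega α).size = size α + 1 := by
  simp only [H.size, H.fold_omega]; rfl

theorem size_theta (α : OT) : (theta α).size = size α + 1 := by
  simp only [H.size, H.fold_theta]; rfl

theorem size_le_of_mem {h : H} {α : OT} (hh : h ∈ α) : h.size ≤ size α :=
  Multiset.le_sum_of_mem (Multiset.mem_map_of_mem _ hh)

/-! ### Membership in formal cardinalities and critical sets -/

theorem mem_FC {J x : ℤ} {α : OT} : x ∈ FC J α ↔ ∃ h ∈ α, x ∈ FC J {h} := by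
  induction α using Multiset.induction with
  | empty => simp [FC]
  | cons a s ih =>
    simp only [FC, Multiset.map_cons, Multiset.sup_cons, Finset.sup_eq_union, Finset.mem_union] at *
    simp [ih]

theorem mem_K {J : ℤ} {γ α : OT} : γ ∈ K J α ↔ ∃ h ∈ α, γ ∈ K J {h} := by
  simp [K]

theorem mem_shift {J n : ℤ} {α : OT} {g : H} : g ∈ shift J n α ↔ ∃ h ∈ α, g = h.shift J n := by
  simp [shift, eq_comm]

theorem shift_singleton (J n : ℤ) (h : H) : shift J n {h} = {h.shift J n} := by
  simp [shift]

theorem mem_FC_shift {I J n x : ℤ} {α : OT} :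
    x ∈ FC I (shift J n α) ↔ ∃ h ∈ α, x ∈ FC I (shift J n {h}) := by
  rw [mem_FC]; simp [mem_shift, shift_singleton]

theorem mem_K_shift {I J n : ℤ} {γ α : OT} :
    γ ∈ K I (shift J n α) ↔ ∃ h ∈ α, γ ∈ K I (shift J n {h}) := by
  rw [mem_K]; simp [mem_shift, shift_singleton]

theorem shift_congr {I J m n : ℤ} {α : OT}
    (h : ∀ h ∈ α, shift I m {h} = shift J n {h}) : shift I m α = shift J n α := by
  refine Multiset.map_congr rfl fun x hx => ?_
  simpa [shift_singleton] using h x hx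

theorem shift_shift_congr {I J I' J' m n m' n' : ℤ} {α : OT}
    (h : ∀ h ∈ α, shift I m (shift J n {h}) = shift I' m' (shift J' n' {h})) :
    shift I m (shift J n α) = shift I' m' (shift J' n' α) := by
  simp only [shift, Multiset.map_map]
  refine Multiset.map_congr rfl fun x hx => ?_
  simpa [shift_singleton] using h x hx

/-! ### Formal cardinalities of shifted terms -/

theorem nonpos_of_mem_FC {x : ℤ} {α : OT} : ∀ {J : ℤ}, x ∈ FC J α → x ≤ 0 := by
  induction α using term_induction with
  | hsum α ih => intro J hx; obtain ⟨h, hh, hx⟩ := mem_FC.1 hx; exact ih h hh hx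
  | homega α ih => intro J hx; rw [FC_omega] at hx; exact ih hx
  | hOmega J' => intro J hx; rw [FC_Omega] at hx; split_ifs at hx <;> simp at hx; omega
  | htheta α ih => intro J hx; rw [FC_theta] at hx; exact ih hx

/-- Levels are recorded relative to the bound: lowering it from `J` to `I` drops the levels in `(I,
J]` and renumbers the others. Under `ϑ` both bounds drop together, so their difference persists. -/
theorem mem_FC_iff_of_le {I J x : ℤ} (hIJ : I ≤ J) {α : OT} :
    x ∈ FC I α ↔ x ≤ 0 ∧ x + (I - J) ∈ FC J α := by
  induction α using term_induction generalizing I J with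
  | hsum α ih =>
    rw [mem_FC, mem_FC]
    constructor
    · rintro ⟨h, hh, hx⟩
      exact ⟨((ih h hh hIJ).1 hx).1, h, hh, ((ih h hh hIJ).1 hx).2⟩
    · rintro ⟨h0, h, hh, hx⟩
      exact ⟨h, hh, (ih h hh hIJ).2 ⟨h0, hx⟩⟩
  | homega α ih => rw [FC_omega, FC_omega]; exact ih hIJ
  | hOmega J' => rw [FC_Omega, FC_Omega]; split_ifs <;> simp <;> omega
  | htheta α ih =>
    rw [FC_theta, FC_theta, ih (by omega : I - 1 ≤ J - 1)]
    simp

/-- Shifting the levels `≤ J` of `α` by `n` keeps them `≤ J`. -/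
def Shiftable (J n : ℤ) (α : OT) : Prop := ∀ x ∈ FC J α, x + n ≤ 0

theorem Shiftable.of_nonpos {J n : ℤ} (hn : n ≤ 0) (α : OT) : Shiftable J n α := fun x hx => by
  have := nonpos_of_mem_FC hx; omega

theorem Shiftable.mem {J n : ℤ} {α : OT} (h : Shiftable J n α) {g : H} (hg : g ∈ α) :
    Shiftable J n {g} := fun x hx => h x (mem_FC.2 ⟨g, hg, hx⟩)

theorem shiftable_omega {J n : ℤ} {α : OT} : Shiftable J n {omega α} ↔ Shiftable J n α := by
  simp [Shiftable, FC_omega]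

theorem shiftable_theta {J n : ℤ} {α : OT} :
    Shiftable J n {theta α} ↔ Shiftable (J - 1) n α := by
  simp [Shiftable, FC_theta]

theorem shiftable_Omega {J n : ℤ} {J' : Level} :
    Shiftable J n {Omega J'} ↔ (J'.1 ≤ J → J'.1 + n ≤ J) := by
  rw [Shiftable, FC_Omega]; split_ifs with h <;> simp [h]; omega

theorem shift_Omega_of_le {J n : ℤ} {J' : Level} (h : J'.1 ≤ J) (h' : J'.1 + n ≤ 0) :
    shift J n {Omega J'} = {Omega ⟨J'.1 + n, h'⟩} := by
  rw [shift_Omega, if_pos h]; simp [Level.clip, h']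

theorem shift_Omega_of_gt {J n : ℤ} {J' : Level} (h : J < J'.1) :
    shift J n {Omega J'} = {Omega J'} := by
  rw [shift_Omega, if_neg (by omega)]

/-- In absolute terms the element `x` is the level `x + I`. Levels at most `J` move by `n` and, by
shiftability, stay at most `J`; those above `J` are fixed. Since `J ≤ 0`, `Level.clip` never takes
effect. -/
theorem mem_FC_shift_iff {I J n x : ℤ} (hJ : J ≤ 0) (hJI : J ≤ I) {α : OT} (hs : Shiftable J n α) :
    x ∈ FC I (shift J n α) ↔
      (x + I ≤ J ∧ x - n + I ≤ J ∧ x - n ∈ FC I α) ∨ (J < x + I ∧ x ∈ FC I α) := by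
  induction α using term_induction generalizing I J with
  | hsum α ih =>
    rw [mem_FC_shift, mem_FC, mem_FC]
    constructor
    · rintro ⟨h, hh, hx⟩
      rcases (ih h hh hJ hJI (hs.mem hh)).1 hx with ⟨h1, h2, h3⟩ | ⟨h1, h2⟩
      · exact .inl ⟨h1, h2, h, hh, h3⟩
      · exact .inr ⟨h1, h, hh, h2⟩
    · rintro (⟨h1, h2, h, hh, h3⟩ | ⟨h1, h, hh, h2⟩)
      · exact ⟨h, hh, (ih h hh hJ hJI (hs.mem hh)).2 (.inl ⟨h1, h2, h3⟩)⟩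
      · exact ⟨h, hh, (ih h hh hJ hJI (hs.mem hh)).2 (.inr ⟨h1, h2⟩)⟩
  | homega α ih =>
    rw [shift_omega, FC_omega, FC_omega]; exact ih hJ hJI (shiftable_omega.1 hs)
  | hOmega J' =>
    rw [shiftable_Omega] at hs
    rcases le_or_gt J'.1 J with h | h
    · have := hs h
      rw [shift_Omega_of_le h (by omega), FC_Omega, FC_Omega, if_pos (by simp; omega),
        if_pos (by omega)]
      simp; omega
    · rw [shift_Omega_of_gt h, FC_Omega]
      split_ifs <;> simp; omega
  | htheta α ih =>
    rw [shift_theta, FC_theta, FC_theta,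
      ih (by omega : J - 1 ≤ 0) (by omega : J - 1 ≤ I - 1) (shiftable_theta.1 hs)]
    constructor <;> rintro (⟨h1, h2, h3⟩ | ⟨h1, h2⟩)
    · exact .inl ⟨by omega, by omega, h3⟩
    · exact .inr ⟨by omega, h2⟩
    · exact .inl ⟨by omega, by omega, h3⟩
    · exact .inr ⟨by omega, h2⟩

theorem mem_FC_shift_self {J n x : ℤ} (hJ : J ≤ 0) {α : OT} (hs : Shiftable J n α) :
    x ∈ FC J (shift J n α) ↔ x - n ∈ FC J α := by
  rw [mem_FC_shift_iff hJ le_rfl hs]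
  constructor
  · rintro (⟨-, -, h⟩ | ⟨h, h'⟩)
    · exact h
    · have := nonpos_of_mem_FC h'; omega
  · intro h
    have h1 := nonpos_of_mem_FC h
    have h2 := hs _ h
    exact .inl ⟨by omega, by omega, h⟩

/-! ### Composition of shifts -/

theorem shift_zero (J : ℤ) (α : OT) : shift J 0 α = α := by
  induction α using term_induction generalizing J with
  | hsum α ih =>
    conv_rhs => rw [← Multiset.map_id α]
    refine Multiset.map_congr rfl fun h hh => ?_
    simpa [shift_singleton] using ih h hh J
  | homega α ih => rw [shift_omega, ih]
  | hOmega J' =>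
    rcases le_or_gt J'.1 J with h | h
    · rw [shift_Omega_of_le h (by simpa using J'.2)]; simp
    · rw [shift_Omega_of_gt h]
  | htheta α ih => rw [shift_theta, ih]

/-- The outer shift also moves the levels that the inner one acts on, so after the exchange the
inner threshold `J` becomes `J + m`. -/
theorem shift_comm {I J m n : ℤ} {α : OT} (hJ : J ≤ 0) (hI : I ≤ 0) (hJI : J ≤ I)
    (hmI : J + m ≤ I) (hs : Shiftable J n α) (hs' : Shiftable I m α) :
    shift I m (shift J n α) = shift (J + m) n (shift I m α) := by
  induction α using term_induction generalizing I J with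
  | hsum α ih =>
    exact shift_shift_congr fun h hh => ih h hh hJ hI hJI hmI (hs.mem hh) (hs'.mem hh)
  | homega α ih =>
    simp only [shift_omega]
    rw [ih hJ hI hJI hmI (shiftable_omega.1 hs) (shiftable_omega.1 hs')]
  | hOmega J' =>
    rw [shiftable_Omega] at hs hs'
    rcases le_or_gt J'.1 J with h | h
    · have := hs h
      rw [shift_Omega_of_le h (by omega), shift_Omega_of_le (by simp; omega) (by simp; omega),
        shift_Omega_of_le (by omega : J'.1 ≤ I) (by omega),
        shift_Omega_of_le (by simp; omega) (by simp; omega)]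
      simp [Omega_inj]; omega
    · rw [shift_Omega_of_gt h]
      rcases le_or_gt J'.1 I with h' | h'
      · have := hs' h'
        rw [shift_Omega_of_le h' (by omega), shift_Omega_of_gt (by simp; omega)]
      · rw [shift_Omega_of_gt h', shift_Omega_of_gt (by omega)]
  | htheta α ih =>
    simp only [shift_theta]
    rw [ih (by omega) (by omega : I - 1 ≤ 0) (by omega) (by omega) (shiftable_theta.1 hs)
      (shiftable_theta.1 hs'), show J - 1 + m = J + m - 1 by ring]

theorem shift_shift {J m n : ℤ} {α : OT} (hJ : J ≤ 0) (hs : Shiftable J n α) :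
    shift J m (shift J n α) = shift J (n + m) α := by
  -- A trivial second shift on the right puts both sides in the form that `shift_shift_congr`
  -- handles summand by summand.
  rw [← shift_zero J (shift J (n + m) α)]
  induction α using term_induction generalizing J with
  | hsum α ih => exact shift_shift_congr fun h hh => ih h hh hJ (hs.mem hh)
  | homega α ih => simp only [shift_omega]; rw [ih hJ (shiftable_omega.1 hs)]
  | hOmega J' =>
    rw [shiftable_Omega] at hs
    rw [shift_zero]
    rcases le_or_gt J'.1 J with h | h
    · have := hs h
      rw [shift_Omega_of_le h (by omega), shift_Omega, if_pos (by simpa using this), shift_Omega,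
        if_pos h, ← add_assoc]
    · rw [shift_Omega_of_gt h, shift_Omega_of_gt h, shift_Omega_of_gt h]
  | htheta α ih =>
    simp only [shift_theta]
    rw [ih (by omega) (shiftable_theta.1 hs)]

theorem shift_neg_shift {J n : ℤ} {α : OT} (hJ : J ≤ 0) (hs : Shiftable J n α) :
    shift J (-n) (shift J n α) = α := by
  rw [shift_shift hJ hs, add_neg_cancel, shift_zero]

/-- Only the occurring levels matter for the bound of a shift. -/
theorem shift_eq_of_le {I J n : ℤ} {α : OT} (hJI : J ≤ I) (h : ∀ x ∈ FC I α, x + I ≤ J) :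
    shift J n α = shift I n α := by
  induction α using term_induction generalizing I J with
  | hsum α ih => exact shift_congr fun g hg => ih g hg hJI fun x hx => h x (mem_FC.2 ⟨g, hg, hx⟩)
  | homega α ih => rw [shift_omega, shift_omega, ih hJI (by simpa [FC_omega] using h)]
  | hOmega J' =>
    rw [shift_Omega, shift_Omega]
    rw [FC_Omega] at h
    by_cases h1 : J'.1 ≤ I
    · have := h (J'.1 - I) (by simp [h1])
      rw [if_pos (by omega), if_pos h1]
    · rw [if_neg (by omega), if_neg h1]
  | htheta α ih =>
    rw [FC_theta] at h
    rw [shift_theta, shift_theta, ih (by omega : J - 1 ≤ I - 1) fun x hx => by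
      have := h x hx; omega]

theorem size_shift (J n : ℤ) (α : OT) : size (shift J n α) = size α := by
  induction α using term_induction generalizing J with
  | hsum α ih =>
    simp only [size, shift, Multiset.map_map]
    refine congrArg _ (Multiset.map_congr rfl fun h hh => ?_)
    simpa [shift_singleton, size_singleton] using ih h hh J
  | homega α ih => rw [shift_omega]; simp [size_singleton, size_omega, ih]
  | hOmega J' => rw [shift_Omega]; split_ifs <;> simp [size_singleton, H.size, H.fold_Omega]
  | htheta α ih => rw [shift_theta]; simp [size_singleton, size_theta, ih]


/-! ### Critical subterms of shifted terms -/

theorem FCbar_lt_iff {α : OT} {J : ℤ} :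
    FCbar α < (J : WithBot ℤ) ↔ ∀ x ∈ FC 0 α, x < J := by
  rw [FCbar, Finset.max, Finset.sup_lt_iff (WithBot.bot_lt_coe J)]
  simp

theorem K_theta_of_lt {J : ℤ} {α : OT} (h : ∀ x ∈ FC 0 {theta α}, x < J) :
    K J {theta α} = {shift 0 (1 - J) {theta α}} := by
  rw [K_theta, if_pos (FCbar_lt_iff.2 h)]

theorem K_theta_of_not_lt {J : ℤ} {α : OT} (h : ¬ ∀ x ∈ FC 0 {theta α}, x < J) :
    K J {theta α} = K (J - 1) α := by
  rw [K_theta, if_neg (fun h' => h (FCbar_lt_iff.1 h'))]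

theorem K_Omega_of_lt {J : ℤ} {J' : Level} (h : J'.1 < J) :
    K J {Omega J'} = {{Omega ⟨J'.1 - (J - 1), by omega⟩}} := by
  rw [K_Omega, dif_pos h]

theorem K_Omega_of_ge {J : ℤ} {J' : Level} (h : J ≤ J'.1) : K J {Omega J'} = ∅ := by
  rw [K_Omega, dif_neg (by omega)]

/-- `K^{< I}` commutes with shifting levels below `I`. -/
theorem K_shift_image {I J n : ℤ} {α : OT} (hJI : J < I) (hI : I ≤ 0) (hs : Shiftable J n α) :
    K I (shift J n α) = shift (J - I + 1) n '' K I α := by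
  induction α using term_induction generalizing I J with
  | hsum α ih =>
    ext γ
    rw [mem_K_shift]
    simp only [Set.mem_image, mem_K (α := α)]
    constructor
    · rintro ⟨h, hh, hγ⟩
      rw [ih h hh hJI hI (hs.mem hh)] at hγ
      obtain ⟨δ, hδ, rfl⟩ := hγ
      exact ⟨δ, ⟨h, hh, hδ⟩, rfl⟩
    · rintro ⟨δ, ⟨h, hh, hδ⟩, rfl⟩
      refine ⟨h, hh, ?_⟩
      rw [ih h hh hJI hI (hs.mem hh)]
      exact ⟨δ, hδ, rfl⟩
  | homega α ih => rw [shift_omega, K_omega, K_omega, ih hJI hI (shiftable_omega.1 hs)]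
  | hOmega J' =>
    rw [shiftable_Omega] at hs
    rcases le_or_gt J'.1 J with h | h
    · have := hs h
      rw [shift_Omega_of_le h (by omega), K_Omega_of_lt (by simp; omega),
        K_Omega_of_lt (by omega), Set.image_singleton,
        shift_Omega_of_le (by simp; omega) (by simp; omega)]
      simp [Omega_inj]; omega
    · rw [shift_Omega_of_gt h]
      rcases lt_or_ge J'.1 I with h' | h'
      · rw [K_Omega_of_lt h', Set.image_singleton, shift_Omega_of_gt (by simp; omega)]
      · rw [K_Omega_of_ge h', Set.image_empty]
  | htheta α ih =>
    -- Only levels at most `J < I` move and they stay at most `J`, so the shift does not affect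
    -- whether the term is critical below `I`.
    have key : (∀ x ∈ FC 0 {theta (shift (J - 1) n α)}, x < I) ↔
        ∀ x ∈ FC 0 {theta α}, x < I := by
      rw [← shift_theta]
      constructor
      · intro h x hx
        by_cases hxJ : x ≤ J
        · omega
        · exact h x ((mem_FC_shift_iff (by omega) (by omega) hs).2 (.inr ⟨by omega, hx⟩))
      · intro h x hx
        rcases (mem_FC_shift_iff (by omega) (by omega) hs).1 hx with ⟨h1, -, -⟩ | ⟨-, h2⟩
        · omega
        · exact h x h2
    rw [shift_theta]
    by_cases h : ∀ x ∈ FC 0 {theta α}, x < I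
    · rw [K_theta_of_lt h, K_theta_of_lt (key.2 h), ← shift_theta, Set.image_singleton,
        shift_comm (by omega) le_rfl (by omega) (by omega) hs,
        show J + (1 - I) = J - I + 1 by ring]
      intro x hx
      have := h x hx; omega
    · rw [K_theta_of_not_lt h, K_theta_of_not_lt (key.not.2 h),
        ih (by omega) (by omega) (shiftable_theta.1 hs)]
      congr 2; ring

/-- `K^{< I}` of a shift, when no levels lie between the bounds. -/
theorem K_shift_eq {I J n : ℤ} {α : OT} (hJ : J ≤ 0) (hI : I ≤ J + 1) (hIn : I - n ≤ J + 1)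
    (hs : Shiftable J n α) : K I (shift J n α) = K (I - n) α := by
  induction α using term_induction generalizing I J with
  | hsum α ih =>
    ext γ
    rw [mem_K_shift, mem_K]
    refine exists_congr fun h => and_congr_right fun hh => ?_
    rw [ih h hh hJ hI hIn (hs.mem hh)]
  | homega α ih => rw [shift_omega, K_omega, K_omega, ih hJ hI hIn (shiftable_omega.1 hs)]
  | hOmega J' =>
    rw [shiftable_Omega] at hs
    rcases le_or_gt J'.1 J with h | h
    · have := hs h
      rw [shift_Omega_of_le h (by omega)]
      rcases lt_or_ge (J'.1 + n) I with h' | h'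
      · rw [K_Omega_of_lt (by simpa using h'), K_Omega_of_lt (by omega)]
        simp [Omega_inj]; omega
      · rw [K_Omega_of_ge (by simpa using h'), K_Omega_of_ge (by omega)]
    · rw [shift_Omega_of_gt h, K_Omega_of_ge (by omega), K_Omega_of_ge (by omega)]
  | htheta α ih =>
    -- A fixed level, being above `J`, fails both tests because `I` and `I - n` are at most `J + 1`;
    -- a moved level passes one exactly when it passes the other.
    have key : (∀ x ∈ FC 0 {theta (shift (J - 1) n α)}, x < I) ↔
        ∀ x ∈ FC 0 {theta α}, x < I - n := by
      rw [← shift_theta]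
      constructor
      · intro h x hx
        by_cases hxJ : x ≤ J
        · have hx' : x - J ∈ FC J {theta α} :=
            (mem_FC_iff_of_le hJ).2 ⟨by omega, by simpa using hx⟩
          have := hs _ hx'
          have := h (x + n) ((mem_FC_shift_iff hJ hJ hs).2
            (.inl ⟨by omega, by omega, by simpa using hx⟩))
          omega
        · have := h x ((mem_FC_shift_iff hJ hJ hs).2 (.inr ⟨by omega, hx⟩))
          omega
      · intro h x hx
        rcases (mem_FC_shift_iff hJ hJ hs).1 hx with ⟨-, -, h3⟩ | ⟨h1, h2⟩
        · have := h _ h3; omega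
        · have := h x h2; omega
    rw [shift_theta]
    by_cases h : ∀ x ∈ FC 0 {theta α}, x < I - n
    -- All levels are below `I - n ≤ J + 1`, so the bounds `J` and `0` select the same ones.
    · have e : shift J n {theta α} = shift 0 n {theta α} :=
        shift_eq_of_le hJ fun x hx => by have := h x hx; omega
      have hs0 : Shiftable 0 n {theta α} := fun x hx => by
        have := h x hx
        have := hs (x - J) ((mem_FC_iff_of_le hJ).2 ⟨by omega, by simpa using hx⟩)
        omega
      rw [K_theta_of_lt h, K_theta_of_lt (key.2 h), ← shift_theta, e, shift_shift le_rfl hs0,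
        show n + (1 - I) = 1 - (I - n) by ring]
    · rw [K_theta_of_not_lt h, K_theta_of_not_lt (key.not.2 h),
        ih (by omega) (by omega) (by omega) (shiftable_theta.1 hs),
        show I - 1 - n = I - n - 1 by ring]

/-- The critical subterms below a smaller level are the critical subterms of the critical
subterms. -/
theorem K_pred {J : ℤ} (hJ : J ≤ 1) {α γ : OT} :
    γ ∈ K (J - 1) α ↔ ∃ δ ∈ K J α, γ ∈ K 0 δ := by
  induction α using term_induction generalizing J γ with
  | hsum α ih =>
    simp only [mem_K (α := α)]
    constructor
    · rintro ⟨h, hh, hγ⟩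
      obtain ⟨δ, h1, h2⟩ := (ih h hh hJ).1 hγ
      exact ⟨δ, ⟨h, hh, h1⟩, h2⟩
    · rintro ⟨δ, ⟨h, hh, h1⟩, h2⟩
      exact ⟨h, hh, (ih h hh hJ).2 ⟨δ, h1, h2⟩⟩
  | homega α ih => rw [K_omega, K_omega]; exact ih hJ
  | hOmega J' =>
    rcases lt_or_ge J'.1 J with h | h
    · rw [K_Omega_of_lt h]
      simp only [Set.mem_singleton_iff, exists_eq_left]
      rcases lt_or_ge J'.1 (J - 1) with h' | h'
      · rw [K_Omega_of_lt h', K_Omega_of_lt (by simp; omega)]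
        simp only [Set.mem_singleton_iff]
        refine iff_of_eq (congrArg (fun I : Level => γ = {Omega I}) (Subtype.ext ?_))
        dsimp only
        ring
      · rw [K_Omega_of_ge h', K_Omega_of_ge (by simp; omega)]
    · rw [K_Omega_of_ge h, K_Omega_of_ge (by omega)]; simp
  | htheta α ih =>
    by_cases h : ∀ x ∈ FC 0 {theta α}, x < J
    · have hs : Shiftable 0 (1 - J) {theta α} := fun x hx => by
        have := h x hx; omega
      have hs' : Shiftable (-1) (1 - J) α := by simpa [shiftable_theta] using hs
      rw [K_theta_of_lt h]
      simp only [Set.mem_singleton_iff, exists_eq_left]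
      have key : (∀ x ∈ FC 0 (shift 0 (1 - J) {theta α}), x < 0) ↔
          ∀ x ∈ FC 0 {theta α}, x < J - 1 := by
        constructor
        · intro h x hx
          have := h (x + (1 - J)) ((mem_FC_shift_self le_rfl hs).2 (by simpa using hx))
          omega
        · intro h x hx
          have := h _ ((mem_FC_shift_self le_rfl hs).1 hx)
          omega
      by_cases h' : ∀ x ∈ FC 0 {theta α}, x < J - 1
      · rw [K_theta_of_lt h']
        have h2 := key.2 h'
        have e := shift_shift (m := 1) le_rfl hs
        rw [shift_theta 0 (1 - J)] at h2 e ⊢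
        rw [K_theta_of_lt h2, sub_zero, e, show 1 - (J - 1) = 1 - J + 1 by ring]
      · rw [K_theta_of_not_lt h']
        have h2 := key.not.2 h'
        rw [shift_theta] at h2 ⊢
        rw [K_theta_of_not_lt h2, show (0 : ℤ) - 1 = -1 by rfl,
          K_shift_eq (by omega) (by omega) (by omega) hs', show -1 - (1 - J) = J - 1 - 1 by ring]
    · rw [K_theta_of_not_lt h, K_theta_of_not_lt (fun h' => h fun x hx => by
        have := h' x hx; omega)]
      exact ih (by omega)

/-- The levels of the critical subterms. -/
theorem mem_FC_pred {J x : ℤ} (hJ : J ≤ 1) {α : OT} :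
    x ∈ FC (J - 1) α ↔ ∃ γ ∈ K J α, x ∈ FC 0 γ := by
  induction α using term_induction generalizing J with
  | hsum α ih =>
    rw [mem_FC]
    simp only [mem_K (α := α)]
    constructor
    · rintro ⟨h, hh, hx⟩
      obtain ⟨γ, h1, h2⟩ := (ih h hh hJ).1 hx
      exact ⟨γ, ⟨h, hh, h1⟩, h2⟩
    · rintro ⟨γ, ⟨h, hh, h1⟩, h2⟩
      exact ⟨h, hh, (ih h hh hJ).2 ⟨γ, h1, h2⟩⟩
  | homega α ih => rw [K_omega, FC_omega]; exact ih hJ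
  | hOmega J' =>
    have := J'.2
    rcases lt_or_ge J'.1 J with h | h
    · rw [K_Omega_of_lt h]
      simp only [Set.mem_singleton_iff, exists_eq_left]
      rw [FC_Omega, FC_Omega, if_pos (by omega), if_pos (by simp; omega)]
      simp
    · rw [K_Omega_of_ge h, FC_Omega, if_neg (by omega)]; simp
  | htheta α ih =>
    by_cases h : ∀ x ∈ FC 0 {theta α}, x < J
    · have hs : Shiftable 0 (1 - J) {theta α} := fun x hx => by
        have := h x hx; omega
      rw [K_theta_of_lt h]
      simp only [Set.mem_singleton_iff, exists_eq_left]
      rw [mem_FC_shift_self le_rfl hs, mem_FC_iff_of_le (by omega : J - 1 ≤ 0)]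
      constructor
      · rintro ⟨-, h2⟩; convert h2 using 1; ring
      · intro h2
        refine ⟨?_, by convert h2 using 1; ring⟩
        have := h _ h2; omega
    · rw [K_theta_of_not_lt h, FC_theta]
      exact ih (by omega)

/-- The inequality is not strict: `ϑα` can be its own critical subterm up to a shift, and likewise
`Ω`. -/
theorem size_le_of_mem_K {J : ℤ} {α γ : OT} (h : γ ∈ K J α) : size γ ≤ size α := by
  induction α using term_induction generalizing J with
  | hsum α ih =>
    obtain ⟨g, hg, hγ⟩ := mem_K.1 h
    exact (ih g hg hγ).trans (by rw [size_singleton]; exact size_le_of_mem hg)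
  | homega α ih =>
    rw [K_omega] at h
    rw [size_singleton, size_omega]
    exact (ih h).trans (by omega)
  | hOmega J' =>
    rcases lt_or_ge J'.1 J with h' | h'
    · rw [K_Omega_of_lt h', Set.mem_singleton_iff] at h
      simp [h, size_singleton, H.size, H.fold_Omega]
    · rw [K_Omega_of_ge h'] at h; exact h.elim
  | htheta α ih =>
    by_cases h' : ∀ x ∈ FC 0 {theta α}, x < J
    · rw [K_theta_of_lt h', Set.mem_singleton_iff] at h
      rw [h, size_shift]
    · rw [K_theta_of_not_lt h'] at h
      rw [size_singleton, size_theta]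
      exact (ih h).trans (by omega)


/-! ### Inversion of the order -/

theorem Lt.of_card_ne_one {y z : OT} (h : Lt y z) (hz : Multiset.card z ≠ 1) :
    (∃ b ∈ z - y, ∀ a ∈ y - z, Lt {a} {b}) ∨
      ∃ b, ∃ a ∈ z, y = {b} ∧ (b ≠ a → Lt {b} {a}) := by
  cases h with
  | sum_sum _ _ hb h => exact .inl ⟨_, hb, h⟩
  | prin_sum _ ha h => exact .inr ⟨_, _, ha, rfl, h⟩
  | _ => simp at hz

theorem Lt.forall_mem {y : OT} {g : H} (h : Lt y {g}) (hy : Multiset.card y ≠ 1) :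
    ∀ a ∈ y, Lt {a} {g} := by
  generalize hz : ({g} : OT) = z at h
  cases h with
  | sum_sum _ hβ => simp [← hz] at hβ
  | sum_prin _ h => exact hz ▸ h
  | _ => simp at hy

theorem Lt.forall_mem' {y : OT} {g : H} (h : Lt y {g}) : ∀ a ∈ y, Lt {a} {g} := by
  by_cases hy : Multiset.card y = 1
  · obtain ⟨a, rfl⟩ := Multiset.card_eq_one.1 hy
    simpa using h
  · exact h.forall_mem hy

theorem Lt.to_omega {g : H} {α : OT} (h : Lt {g} {omega α}) :
    (∃ γ, g = omega γ ∧ Lt γ α) ∨ (g.IsSC ∧ ({g} ≠ α → Lt {g} α)) := by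
  generalize hy : ({g} : OT) = y at h
  generalize hz : ({omega α} : OT) = z at h
  cases h with
  | omega_omega h =>
    simp only [Multiset.singleton_inj, omega_inj] at hy hz
    subst hz
    exact .inl ⟨_, hy, h⟩
  | sc_omega hb h =>
    simp only [Multiset.singleton_inj, omega_inj] at hy hz
    subst hy hz
    exact .inr ⟨hb, h⟩
  | sum_sum hα => simp [← hy] at hα
  | prin_sum hα => simp [← hz] at hα
  | sum_prin hα => simp [← hy] at hα
  | omega_sc hb =>
    simp only [Multiset.singleton_inj] at hz
    exact (hb _ hz.symm).elim
  | _ => simp [omega_ne_Omega, omega_ne_theta] at hz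

theorem Lt.of_omega_sc {g : H} {γ : OT} (hg : g.IsSC) (h : Lt {omega γ} {g}) : Lt γ {g} := by
  generalize hy : ({omega γ} : OT) = y at h
  generalize hz : ({g} : OT) = z at h
  cases h with
  | omega_omega h =>
    simp only [Multiset.singleton_inj] at hz
    exact (hg _ hz).elim
  | sc_omega hb h =>
    simp only [Multiset.singleton_inj] at hy
    exact (hb _ hy.symm).elim
  | omega_sc _ h =>
    simp only [Multiset.singleton_inj, omega_inj] at hy hz
    subst hy hz
    exact h
  | sum_sum hα => simp [← hy] at hα
  | prin_sum hα => simp [← hz] at hα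
  | sum_prin hα => simp [← hy] at hα
  | _ => simp [omega_ne_Omega, omega_ne_theta] at hy

theorem Lt.Omega_theta_inv {J : Level} {α : OT} (h : Lt {Omega J} {theta α}) :
    ∃ γ ∈ K 0 α, {Omega J} ≠ γ → Lt {Omega J} γ := by
  generalize hy : ({Omega J} : OT) = y at h
  generalize hz : ({theta α} : OT) = z at h
  cases h with
  | Omega_theta hβ h =>
    simp only [Multiset.singleton_inj, theta_inj] at hz
    exact ⟨_, hz ▸ hβ, h⟩
  | sum_sum hα => simp [← hy] at hα
  | prin_sum hα => simp [← hz] at hα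
  | sum_prin hα => simp [← hy] at hα
  | Omega_Omega => simp [Omega_ne_theta.symm] at hz
  | sc_omega => simp [omega_ne_theta.symm] at hz
  | _ => simp [omega_ne_Omega.symm, Omega_ne_theta] at hy

theorem Lt.theta_theta_inv {α β : OT} (h : Lt {theta α} {theta β}) :
    (Lt α β ∧ ∀ γ ∈ K 0 α, Lt γ {theta β}) ∨
      ∃ γ ∈ K 0 β, {theta α} ≠ γ → Lt {theta α} γ := by
  generalize hy : ({theta α} : OT) = y at h
  generalize hz : ({theta β} : OT) = z at h
  cases h with
  | theta_theta_of_lt hlt h =>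
    simp only [Multiset.singleton_inj, theta_inj] at hy hz
    subst hy hz
    exact .inl ⟨hlt, h⟩
  | theta_theta_of_gt hgt hγ h =>
    simp only [Multiset.singleton_inj, theta_inj] at hz
    exact .inr ⟨_, hz ▸ hγ, h⟩
  | sum_sum hα => simp [← hy] at hα
  | prin_sum hα => simp [← hz] at hα
  | sum_prin hα => simp [← hy] at hα
  | theta_Omega => simp [Omega_ne_theta.symm] at hz
  | sc_omega => simp [omega_ne_theta.symm] at hz
  | _ => simp [omega_ne_theta.symm, Omega_ne_theta.symm] at hy

/-! ### The order and the levels -/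

/-- The critical subterms of `α` carry exactly the levels visible in `ϑα`; this is why the `ϑ`
clauses of the order respect levels. -/
theorem mem_FC_theta_iff {x : ℤ} {α : OT} :
    x ∈ FC 0 {theta α} ↔ ∃ γ ∈ K 0 α, x ∈ FC 0 γ := by
  rw [FC_theta, mem_FC_pred (by omega)]

/-- The order is monotone in the formal cardinality. -/
theorem Lt.level_le {y z : OT} (h : Lt y z) {c : ℤ} (hc : ∀ x ∈ FC 0 z, x ≤ c) :
    ∀ x ∈ FC 0 y, x ≤ c := by
  induction h with
  | @sum_sum α β b _ _ hb _ ih =>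
    intro x hx
    obtain ⟨a, ha, hx⟩ := mem_FC.1 hx
    by_cases hab : a ∈ β
    · exact hc x (mem_FC.2 ⟨a, hab, hx⟩)
    · refine ih a ?_ (fun y hy => hc y (mem_FC.2 ⟨b, ?_, hy⟩)) x hx
      · rw [Multiset.mem_sub, Multiset.count_eq_zero_of_notMem hab]
        exact Multiset.count_pos.2 ha
      · exact Multiset.mem_of_le (Multiset.sub_le_self _ _) hb
  | @prin_sum b a α _ ha _ ih =>
    by_cases hba : b = a
    · subst hba
      exact fun x hx => hc x (mem_FC.2 ⟨b, ha, hx⟩)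
    · exact ih hba fun y hy => hc y (mem_FC.2 ⟨a, ha, hy⟩)
  | sum_prin _ _ ih =>
    intro x hx
    obtain ⟨a, ha, hx⟩ := mem_FC.1 hx
    exact ih a ha hc x hx
  | omega_omega _ ih => rw [FC_omega] at *; exact ih hc
  | @sc_omega b α _ _ ih =>
    rw [FC_omega] at hc
    by_cases hb : {b} = α
    · rw [hb]; exact hc
    · exact ih hb hc
  | omega_sc _ _ ih => rw [FC_omega]; exact ih hc
  | @Omega_Omega J J' h =>
    intro x hx
    have := J'.2
    have := hc (J'.1) (by simp [FC_Omega, J'.2])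
    simp [FC_Omega, J.2] at hx
    omega
  | @Omega_theta J α β hβ _ ih =>
    have hβc : ∀ x ∈ FC 0 β, x ≤ c := fun x hx => hc x (mem_FC_theta_iff.2 ⟨β, hβ, hx⟩)
    by_cases h : {Omega J} = β
    · rw [h]; exact hβc
    · exact ih h hβc
  | theta_Omega _ ih =>
    intro x hx
    obtain ⟨γ, hγ, hx⟩ := mem_FC_theta_iff.1 hx
    exact ih γ hγ hc x hx
  | theta_theta_of_lt _ _ _ ih =>
    intro x hx
    obtain ⟨γ, hγ, hx⟩ := mem_FC_theta_iff.1 hx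
    exact ih γ hγ hc x hx
  | @theta_theta_of_gt α β γ _ hγ _ _ ih =>
    have hγc : ∀ x ∈ FC 0 γ, x ≤ c := fun x hx => hc x (mem_FC_theta_iff.2 ⟨γ, hγ, hx⟩)
    by_cases h : {theta α} = γ
    · rw [h]; exact hγc
    · exact ih h hγc

/-- The strict form of `Lt.level_le` for an upper term `Ω`: everything below `Ω^(0)` has only
negative levels. -/
theorem Lt.level_lt {y : OT} {J : Level} (h : Lt y {Omega J}) : ∀ x ∈ FC 0 y, x < J.1 := by
  generalize hz : ({Omega J} : OT) = z at h
  induction h with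
  | sum_sum _ hβ => simp [← hz] at hβ
  | prin_sum hα => simp [← hz] at hα
  | sum_prin _ _ ih =>
    intro x hx
    obtain ⟨a, ha, hx⟩ := mem_FC.1 hx
    exact ih a ha hz x hx
  | omega_omega => simp [omega_ne_Omega.symm] at hz
  | sc_omega => simp [omega_ne_Omega.symm] at hz
  | omega_sc _ _ ih => rw [FC_omega]; exact ih hz
  | @Omega_Omega J₁ J₂ h =>
    intro x hx
    simp only [Multiset.singleton_inj, Omega_inj] at hz
    subst hz
    simp [FC_Omega, J₁.2] at hx
    omega
  | Omega_theta => simp [Omega_ne_theta] at hz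
  | theta_Omega _ ih =>
    intro x hx
    obtain ⟨γ, hγ, hx⟩ := mem_FC_theta_iff.1 hx
    exact ih γ hγ hz x hx
  | theta_theta_of_lt => simp [Omega_ne_theta] at hz
  | theta_theta_of_gt => simp [Omega_ne_theta] at hz

/-! ### Shifting preserves the order -/

theorem Shiftable.of_K {J n : ℤ} {α γ : OT} (hJ : J ≤ 0) (hs : Shiftable (J - 1) n α)
    (hγ : γ ∈ K 0 α) : Shiftable J n γ := fun x hx => by
  have h := (mem_FC_iff_of_le hJ).1 hx
  refine hs x ?_
  rw [mem_FC_iff_of_le (by omega : J - 1 ≤ 0 - 1)]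
  exact ⟨h.1, (mem_FC_pred (by omega)).2 ⟨γ, hγ, by convert h.2 using 1; ring⟩⟩

theorem shift_inj {J n : ℤ} {α β : OT} (hJ : J ≤ 0) (hα : Shiftable J n α)
    (hβ : Shiftable J n β) (h : shift J n α = shift J n β) : α = β := by
  rw [← shift_neg_shift hJ hα, h, shift_neg_shift hJ hβ]

theorem H.IsSC.shift {h : H} (hh : h.IsSC) (J n : ℤ) : (h.shift J n).IsSC := by
  rcases h.cases_on with ⟨α, rfl⟩ | ⟨J', rfl⟩ | ⟨α, rfl⟩
  · exact (not_isSC_omega _ hh).elim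
  · have := shift_Omega J n J'
    rw [shift_singleton] at this
    split_ifs at this <;> rw [Multiset.singleton_inj] at this <;> rw [this] <;> exact isSC_Omega _
  · have := shift_theta J n α
    rw [shift_singleton, Multiset.singleton_inj] at this
    rw [this]; exact isSC_theta _

theorem card_shift (J n : ℤ) (α : OT) : Multiset.card (shift J n α) = Multiset.card α := by
  simp [PolyOT.shift]

theorem mem_shift_of_mem {J n : ℤ} {α : OT} {h : H} (hh : h ∈ α) : h.shift J n ∈ shift J n α :=
  mem_shift.2 ⟨h, hh, rfl⟩

/-- Cancel the image of `α ∩ β` from both sides. This needs no injectivity of the shift. -/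
theorem shift_sub_shift (J n : ℤ) (α β : OT) :
    shift J n α - shift J n β = shift J n (α - β) - shift J n (β - α) := by
  have key : ∀ α β : OT, shift J n α = shift J n (α ∩ β) + shift J n (α - β) := fun α β => by
    rw [PolyOT.shift, PolyOT.shift, PolyOT.shift, ← Multiset.map_add, add_comm,
      Multiset.sub_add_inter]
  conv_lhs => rw [key α β, key β α, Multiset.inter_comm β α]
  exact add_tsub_add_eq_tsub_left _ _ _

/-- Induction on the derivation. The clauses involving `ϑ` survive because `K 0` commutes with
shifting: bound `J - 1` inside `ϑ` becomes bound `J` on critical subterms. Injectivity of shifts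
handles multiset differences. -/
theorem Lt.shift {y z : OT} (h : Lt y z) {J n : ℤ} (hJ : J ≤ 0) (hy : Shiftable J n y)
    (hz : Shiftable J n z) : Lt (shift J n y) (shift J n z) := by
  induction h generalizing J with
  | @sum_sum α β b hα hβ hb h ih =>
    have hbβ : b ∈ β := Multiset.mem_of_le (Multiset.sub_le_self _ _) hb
    have ih' : ∀ a ∈ α - β, Lt {a.shift J n} {b.shift J n} := fun a ha => by
      have := ih a ha hJ (hy.mem (Multiset.mem_of_le (Multiset.sub_le_self _ _) ha)) (hz.mem hbβ)
      rwa [shift_singleton, shift_singleton] at this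
    refine .sum_sum (b := b.shift J n) (by rwa [card_shift]) (by rwa [card_shift]) ?_ ?_
    · rw [shift_sub_shift, Multiset.mem_sub, Multiset.count_eq_zero_of_notMem]
      · exact Multiset.count_pos.2 (mem_shift_of_mem hb)
      -- If the image of `b` were also the image of some `a ∈ α - β`, then `a = b` would lie in both
      -- `α - β` and `β - α`.
      · intro hmem
        obtain ⟨a, ha, e⟩ := mem_shift.1 hmem
        have haα : a ∈ α := Multiset.mem_of_le (Multiset.sub_le_self _ _) ha
        have : ({b} : OT) = {a} := shift_inj hJ (hz.mem hbβ) (hy.mem haα)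
          (by rw [shift_singleton, shift_singleton, e])
        rw [Multiset.singleton_inj] at this
        subst this
        rw [Multiset.mem_sub] at ha hb
        omega
    · intro a ha
      rw [shift_sub_shift] at ha
      obtain ⟨a', ha', rfl⟩ := mem_shift.1 (Multiset.mem_of_le (Multiset.sub_le_self _ _) ha)
      exact ih' a' ha'
  | @prin_sum b a α hα ha h ih =>
    rw [shift_singleton]
    refine .prin_sum (by rwa [card_shift]) (mem_shift_of_mem ha) fun hne => ?_
    rw [← shift_singleton, ← shift_singleton]
    exact ih (fun e => hne (by rw [e])) hJ hy (hz.mem ha)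
  | @sum_prin α b hα h ih =>
    rw [shift_singleton]
    refine .sum_prin (by rwa [card_shift]) fun g hg => ?_
    obtain ⟨a, ha, rfl⟩ := mem_shift.1 hg
    rw [← shift_singleton, ← shift_singleton]
    exact ih a ha hJ (hy.mem ha) hz
  | omega_omega h ih =>
    rw [shift_omega, shift_omega]
    exact .omega_omega (ih hJ (shiftable_omega.1 hy) (shiftable_omega.1 hz))
  | sc_omega hb h ih =>
    rw [shift_omega, shift_singleton]
    refine .sc_omega (hb.shift J n) fun hne => ?_
    rw [← shift_singleton] at hne ⊢
    exact ih (fun e => hne (by rw [e])) hJ hy (shiftable_omega.1 hz)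
  | omega_sc hb h ih =>
    have := ih hJ (shiftable_omega.1 hy) hz
    rw [shift_singleton] at this
    rw [shift_omega, shift_singleton]
    exact .omega_sc (hb.shift J n) this
  | @Omega_Omega J₁ J₂ h =>
    rw [shiftable_Omega] at hy hz
    rcases le_or_gt J₁.1 J with h1 | h1 <;> rcases le_or_gt J₂.1 J with h2 | h2
    · have := hy h1
      have := hz h2
      rw [shift_Omega_of_le h1 (by omega), shift_Omega_of_le h2 (by omega)]
      exact .Omega_Omega (by simpa using h)
    · have := hy h1
      rw [shift_Omega_of_le h1 (by omega), shift_Omega_of_gt h2]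
      exact .Omega_Omega (by simp; omega)
    · omega
    · rw [shift_Omega_of_gt h1, shift_Omega_of_gt h2]
      exact .Omega_Omega h
  | @Omega_theta J₁ α β hβ h ih =>
    have hs := shiftable_theta.1 hz
    have hβs := hs.of_K hJ hβ
    have hmem : PolyOT.shift J n β ∈ K 0 (PolyOT.shift (J - 1) n α) := by
      rw [K_shift_image (by omega) le_rfl hs]
      exact ⟨β, hβ, by congr 1; ring⟩
    obtain ⟨J₂, hJ₂⟩ : ∃ J₂, PolyOT.shift J n {Omega J₁} = {Omega J₂} := by
      rw [shift_Omega]; split_ifs <;> exact ⟨_, rfl⟩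
    rw [shift_theta, hJ₂]
    refine .Omega_theta hmem fun hne => ?_
    rw [← hJ₂] at hne ⊢
    exact ih (fun e => hne (by rw [e])) hJ hy hβs
  | @theta_Omega α J₁ h ih =>
    have hs := shiftable_theta.1 hy
    obtain ⟨J₂, hJ₂⟩ : ∃ J₂, PolyOT.shift J n {Omega J₁} = {Omega J₂} := by
      rw [shift_Omega]; split_ifs <;> exact ⟨_, rfl⟩
    rw [shift_theta, hJ₂]
    refine .theta_Omega fun γ hγ => ?_
    rw [K_shift_image (by omega) le_rfl hs] at hγ
    obtain ⟨δ, hδ, rfl⟩ := hγ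
    rw [← hJ₂, show J - 1 - 0 + 1 = J by ring]
    exact ih δ hδ hJ (hs.of_K hJ hδ) hz
  | @theta_theta_of_lt α β hlt h ih1 ih2 =>
    have hs := shiftable_theta.1 hy
    have hs' := shiftable_theta.1 hz
    rw [shift_theta, shift_theta]
    refine .theta_theta_of_lt (ih1 (by omega) hs hs') fun γ hγ => ?_
    rw [K_shift_image (by omega) le_rfl hs] at hγ
    obtain ⟨δ, hδ, rfl⟩ := hγ
    rw [← shift_theta, show J - 1 - 0 + 1 = J by ring]
    exact ih2 δ hδ hJ (hs.of_K hJ hδ) hz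
  | @theta_theta_of_gt α β γ hgt hγ h ih1 ih2 =>
    have hs := shiftable_theta.1 hy
    have hs' := shiftable_theta.1 hz
    have hmem : PolyOT.shift J n γ ∈ K 0 (PolyOT.shift (J - 1) n β) := by
      rw [K_shift_image (by omega) le_rfl hs']
      exact ⟨γ, hγ, by congr 1; ring⟩
    rw [shift_theta, shift_theta]
    refine .theta_theta_of_gt (ih1 (by omega) hs' hs) hmem fun hne => ?_
    rw [← shift_theta] at hne ⊢
    exact ih2 (fun e => hne (by rw [e])) hJ hy (hs'.of_K hJ hγ)

/-- A strongly critical component of a term is at most that term. -/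
theorem le_of_mem_K_one {α γ : OT} (h : γ ∈ K 1 α) : γ = α ∨ Lt γ α := by
  suffices ∃ s : H, s.IsSC ∧ γ = {s} ∧ ({s} ≠ α → Lt {s} α) by
    obtain ⟨s, -, rfl, hs⟩ := this
    exact or_iff_not_imp_left.2 hs
  induction α using term_induction with
  | hsum α ih =>
    obtain ⟨g, hg, hγ⟩ := mem_K.1 h
    obtain ⟨s, hs, rfl, h'⟩ := ih g hg hγ
    refine ⟨s, hs, rfl, fun hne => ?_⟩
    by_cases hα : Multiset.card α = 1
    · obtain ⟨a, rfl⟩ := Multiset.card_eq_one.1 hα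
      rw [Multiset.mem_singleton] at hg
      subst hg
      exact h' hne
    · exact .prin_sum hα hg fun hne => h' (by simpa using hne)
  | homega α ih =>
    rw [K_omega] at h
    obtain ⟨s, hs, rfl, h'⟩ := ih h
    exact ⟨s, hs, rfl, fun _ => .sc_omega hs h'⟩
  | hOmega J =>
    have := J.2
    rw [K_Omega_of_lt (by omega)] at h
    simp only [sub_self, sub_zero, Subtype.coe_eta, Set.mem_singleton_iff] at h
    exact ⟨Omega J, isSC_Omega J, h, fun h => (h rfl).elim⟩
  | htheta α =>
    rw [K_theta_of_lt fun x hx => by have := nonpos_of_mem_FC hx; omega, sub_self,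
      shift_zero] at h
    exact ⟨theta α, isSC_theta α, h, fun h => (h rfl).elim⟩


/-! ### Well-founded parts -/

theorem mem_wfPart_of_forall {S : Set OT} {α : OT} (hα : α ∈ S)
    (h : ∀ β ∈ S, Lt β α → β ∈ wfPart S) : α ∈ wfPart S :=
  ⟨hα, Acc.intro _ fun β hβ => (h β hβ.1 hβ.2.2).2⟩

theorem mem_wfPart_of_lt {S : Set OT} {α β : OT} (hα : α ∈ wfPart S) (hβ : β ∈ S)
    (h : Lt β α) : β ∈ wfPart S := ⟨hβ, hα.2.inv ⟨hβ, hα.1, h⟩⟩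

theorem wfPart_induction {S : Set OT} {P : OT → Prop}
    (h : ∀ α ∈ wfPart S, (∀ β ∈ wfPart S, Lt β α → P β) → P α) {α : OT} (hα : α ∈ wfPart S) :
    P α := by
  obtain ⟨hS, hacc⟩ := hα
  induction hacc with
  | intro α hacc ih =>
    exact h α ⟨hS, Acc.intro _ hacc⟩ fun β hβ hlt => ih β ⟨hβ.1, hS, hlt⟩ hβ.1

/-- If the terms `{h}`, `h ∈ α`, are in the well-founded part, then so is `α`. -/
theorem mem_wfPart_of_summands {S : Set OT} (hS : ∀ α, α ∈ S ↔ ∀ h ∈ α, {h} ∈ S) {α : OT}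
    (hα : ∀ h ∈ α, {h} ∈ wfPart S) : α ∈ wfPart S := by
  -- Restricting to accessible singletons makes `r` well-founded, and hence also its multiset
  -- extension `Relation.CutExpand r`.
  let r : H → H → Prop := fun g h => {g} ∈ wfPart S ∧ {h} ∈ wfPart S ∧ Lt {g} {h}
  have hr : WellFounded r := by
    refine ⟨fun h => ?_⟩
    by_cases hh : ({h} : OT) ∈ wfPart S
    · suffices ∀ α ∈ wfPart S, ∀ h, α = {h} → Acc r h from this _ hh _ rfl
      intro α hα
      refine wfPart_induction (P := fun α => ∀ h, α = {h} → Acc r h) ?_ hα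
      rintro _ - ih h rfl
      exact Acc.intro _ fun g hg => ih {g} hg.1 hg.2.2 g rfl
    · exact Acc.intro _ fun g hg => (hh hg.2.1).elim
  have : Std.Irrefl r := ⟨fun h => hr.irrefl.irrefl h⟩
  have hle : ∀ s t : Multiset H, s ≤ t → Relation.ReflTransGen (Relation.CutExpand r) s t := by
    intro s t hst
    obtain ⟨u, rfl⟩ := Multiset.le_iff_exists_add.1 hst
    induction u using Multiset.induction with
    | empty => rw [add_zero]
    | cons a u ih =>
      refine (ih (Multiset.le_add_right _ _)).tail ⟨0, a, by simp, ?_⟩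
      rw [Multiset.add_cons, ← Multiset.singleton_add, add_comm]; simp
  have hacc : Acc (Relation.TransGen (Relation.CutExpand r)) α := hr.cutExpand.transGen.apply α
  induction hacc with
  | intro α _ ih =>
    by_cases hc : Multiset.card α = 1
    · obtain ⟨h, rfl⟩ := Multiset.card_eq_one.1 hc
      exact hα h (by simp)
    refine mem_wfPart_of_forall ((hS α).2 fun h hh => (hα h hh).1) fun β hβ hlt => ?_
    rcases hlt.of_card_ne_one hc with ⟨b, hb, hab⟩ | ⟨b, a, ha, rfl, hba⟩
    · have hb' := hα b (Multiset.mem_of_le (Multiset.sub_le_self _ _) hb)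
      have hβα : ∀ a ∈ β - α, {a} ∈ wfPart S := fun a ha =>
        mem_wfPart_of_lt hb' ((hS β).1 hβ a (Multiset.mem_of_le (Multiset.sub_le_self _ _) ha))
          (hab a ha)
      refine ih β ?_ fun h hh => ?_
      -- Discard summands of `α` until `β ∩ α + {b}` is left, then replace `b` by the smaller
      -- summands `β - α`; the result is `β`.
      · refine Relation.TransGen.head' (b := β ∩ α + {b})
          ⟨β - α, b, fun a ha => ⟨hβα a ha, hb', hab a ha⟩, ?_⟩ (hle _ _ ?_)
        · conv_lhs => rw [← Multiset.sub_add_inter β α, add_assoc, add_comm]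
        · conv_rhs => rw [← Multiset.sub_add_inter α β, add_comm, Multiset.inter_comm]
          exact add_le_add le_rfl (Multiset.singleton_le.2 hb)
      · by_cases hhα : h ∈ α
        · exact hα h hhα
        · refine hβα h ?_
          rw [Multiset.mem_sub, Multiset.count_eq_zero_of_notMem hhα]
          exact Multiset.count_pos.2 hh
    · by_cases e : b = a
      · exact e ▸ hα a ha
      · exact mem_wfPart_of_lt (hα a ha) hβ (hba e)

/-! ### The stages of the construction -/

/-- The terms whose critical subterms are accessible at the previous stage, among the terms whose
levels lie strictly between `-m` and `1`. -/
noncomputable def Stage : ℕ → Set OT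
  | 0 => {α | ∀ x ∈ FC 0 α, -((0 : ℕ) : ℤ) < x}
  | m + 1 => {α | (∀ x ∈ FC 0 α, -((m + 1 : ℕ) : ℤ) < x) ∧ ∀ γ ∈ K 0 α, γ ∈ wfPart (Stage m)}

/-- A uniform description: at stage zero the second condition is vacuous. -/
theorem mem_Stage {m : ℕ} {α : OT} : α ∈ Stage m ↔ (∀ x ∈ FC 0 α, -(m : ℤ) < x) ∧
    ∀ k, m = k + 1 → ∀ γ ∈ K 0 α, γ ∈ wfPart (Stage k) := by
  cases m with
  | zero => simp [Stage]
  | succ m =>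
    simp only [Stage, Set.mem_ofPred_eq]
    refine and_congr_right fun _ => ⟨?_, fun h => h m rfl⟩
    intro h k hk
    obtain rfl : m = k := by omega
    exact h

theorem mem_Stage_iff_summands {m : ℕ} (α : OT) : α ∈ Stage m ↔ ∀ h ∈ α, {h} ∈ Stage m := by
  simp only [mem_Stage]
  constructor
  · exact fun h g hg => ⟨fun x hx => h.1 x (mem_FC.2 ⟨g, hg, hx⟩),
      fun k hk γ hγ => h.2 k hk γ (mem_K.2 ⟨g, hg, hγ⟩)⟩
  · refine fun h => ⟨fun x hx => ?_, fun k hk γ hγ => ?_⟩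
    · obtain ⟨g, hg, hx⟩ := mem_FC.1 hx
      exact (h g hg).1 x hx
    · obtain ⟨g, hg, hγ⟩ := mem_K.1 hγ
      exact (h g hg).2 k hk γ hγ

theorem omega_mem_Stage {m : ℕ} {α : OT} : {omega α} ∈ Stage m ↔ α ∈ Stage m := by
  simp only [mem_Stage, FC_omega, K_omega]

/-! ### Closure of accessibility under sums, `ω`, shifting and `ϑ` -/

theorem mem_Acc_of_summands {m : ℕ} {α : OT} (hα : ∀ h ∈ α, {h} ∈ wfPart (Stage m)) :
    α ∈ wfPart (Stage m) :=
  mem_wfPart_of_summands mem_Stage_iff_summands hα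

/-- Induction along the accessible `α`: each summand of a predecessor of `ω^α` is either `ω^γ` with
`γ < α`, or a strongly critical term at most `α`. -/
theorem omega_mem_Acc {m : ℕ} {α : OT} (hα : α ∈ wfPart (Stage m)) :
    {omega α} ∈ wfPart (Stage m) := by
  refine wfPart_induction (P := fun α => {omega α} ∈ wfPart (Stage m)) ?_ hα
  intro α hα ih
  refine mem_wfPart_of_forall (omega_mem_Stage.2 hα.1) fun β hβ hlt => ?_
  refine mem_Acc_of_summands fun g hg => ?_
  have hgS := (mem_Stage_iff_summands β).1 hβ g hg
  rcases (hlt.forall_mem' g hg).to_omega with ⟨γ, rfl, h⟩ | ⟨-, h⟩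
  · exact ih γ (mem_wfPart_of_lt hα (omega_mem_Stage.1 hgS) h) h
  · by_cases e : {g} = α
    · rw [e]; exact hα
    · exact mem_wfPart_of_lt hα hgS (h e)

/-- Lowering all levels by one makes the strongly critical components of `α` critical below `0`, and
the renumbering in `K` undoes the shift. -/
theorem K_pred_shift {α : OT} : K 0 (shift 0 (-1) α) = K 1 α :=
  K_shift_eq le_rfl (by omega) (by omega) (.of_nonpos (by omega) α)

theorem Stage_of_mem_K_one {m : ℕ} {α γ : OT} (hα : α ∈ Stage m) (hγ : γ ∈ K 1 α) :
    γ ∈ Stage m := by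
  rw [mem_Stage] at hα ⊢
  refine ⟨fun x hx => hα.1 x ?_, fun k hk δ hδ => hα.2 k hk δ ?_⟩
  · exact (mem_FC_pred (J := 1) le_rfl).2 ⟨γ, hγ, hx⟩
  · exact (K_pred (J := 1) le_rfl).2 ⟨γ, hγ, hδ⟩

/-- Accessible terms remain accessible at the next stage. -/
theorem shift_mem_Acc {m : ℕ} {α : OT} (hα : α ∈ wfPart (Stage m)) :
    shift 0 (-1) α ∈ wfPart (Stage (m + 1)) := by
  refine wfPart_induction (P := fun α => shift 0 (-1) α ∈ wfPart (Stage (m + 1))) ?_ hα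
  intro α hα ih
  have hs : Shiftable 0 (-1) α := .of_nonpos (by omega) α
  refine mem_wfPart_of_forall (mem_Stage.2 ⟨fun x hx => ?_, fun k hk γ hγ => ?_⟩)
    fun β hβ hlt => ?_
  · rw [mem_FC_shift_self le_rfl hs] at hx
    have := (mem_Stage.1 hα.1).1 _ hx
    push_cast; omega
  · obtain rfl : m = k := by omega
    rw [K_pred_shift] at hγ
    rcases le_of_mem_K_one hγ with rfl | h
    · exact hα
    · exact mem_wfPart_of_lt hα (Stage_of_mem_K_one hα.1 hγ) h
  · rw [mem_Stage] at hβ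
    -- A predecessor inherits negative levels, so it is itself a shift down by one, and the
    -- induction hypothesis applies to its shift up.
    have hβ0 : ∀ x ∈ FC 0 β, x ≤ -1 := hlt.level_le fun x hx => by
      rw [mem_FC_shift_self le_rfl hs] at hx
      have := nonpos_of_mem_FC hx; omega
    have hβs : Shiftable 0 1 β := fun x hx => by have := hβ0 x hx; omega
    have e : shift 0 (-1) (shift 0 1 β) = β := shift_neg_shift le_rfl hβs
    have hαs : Shiftable 0 1 (shift 0 (-1) α) := fun x hx => by
      rw [mem_FC_shift_self le_rfl hs] at hx
      have := nonpos_of_mem_FC hx; omega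
    have hlt' := hlt.shift le_rfl hβs hαs
    rw [shift_shift le_rfl hs, neg_add_cancel, shift_zero] at hlt'
    rw [← e]
    refine ih _ (mem_wfPart_of_lt hα (mem_Stage.2 ⟨fun x hx => ?_, fun k hk γ hγ => ?_⟩) hlt') hlt'
    · rw [mem_FC_shift_self le_rfl hβs] at hx
      have := hβ.1 _ hx
      push_cast at this; omega
    · obtain ⟨δ, hδ, hγ⟩ := (K_pred (J := 1) le_rfl).1 hγ
      rw [← K_pred_shift, e] at hδ
      exact (mem_Stage.1 (hβ.2 m rfl δ hδ).1).2 k hk γ hγ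

/-- A term of negative formal cardinality is accessible. -/
theorem mem_Acc_of_level_neg {m : ℕ} {α : OT} (hα : α ∈ Stage (m + 1))
    (h : ∀ x ∈ FC 0 α, x < 0) : α ∈ wfPart (Stage (m + 1)) := by
  -- The shift up of `s` is a critical subterm, hence accessible one stage earlier by definition of
  -- the stage; `shift_mem_Acc` brings it back.
  have hSC : ∀ s : H, K 0 {s} = {shift 0 1 {s}} → {s} ∈ Stage (m + 1) →
      (∀ x ∈ FC 0 {s}, x < 0) → {s} ∈ wfPart (Stage (m + 1)) := fun s hs hS hs0 => by
    have h1 := (mem_Stage.1 hS).2 m rfl (shift 0 1 {s}) (by rw [hs]; rfl)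
    have h2 := shift_mem_Acc h1
    rwa [shift_neg_shift le_rfl fun x hx => by have := hs0 x hx; omega] at h2
  induction α using term_induction with
  | hsum α ih =>
    exact mem_Acc_of_summands fun g hg => ih g hg ((mem_Stage_iff_summands α).1 hα g hg)
      fun x hx => h x (mem_FC.2 ⟨g, hg, hx⟩)
  | homega α ih =>
    rw [FC_omega] at h
    exact omega_mem_Acc (ih (omega_mem_Stage.1 hα) h)
  | hOmega J =>
    have hJ : J.1 < 0 := h J.1 (by simp [FC_Omega, J.2])
    refine hSC _ ?_ hα h
    rw [K_Omega_of_lt hJ, shift_Omega_of_le J.2 (by omega)]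
    simp
  | htheta α =>
    refine hSC _ ?_ hα h
    rw [K_theta_of_lt h, sub_zero]

/-- Collapsing preserves accessibility. -/
theorem theta_mem_Acc {m : ℕ} {α : OT} (hα : α ∈ wfPart (Stage (m + 1)))
    (h0 : m = 0 ∨ ¬ ∀ x ∈ FC 0 {theta α}, x < 0) : {theta α} ∈ wfPart (Stage m) := by
  revert h0
  refine wfPart_induction (P := fun α => (m = 0 ∨ ¬ ∀ x ∈ FC 0 {theta α}, x < 0) →
    {theta α} ∈ wfPart (Stage m)) ?_ hα
  intro α hα ih h0
  have hKα : ∀ γ ∈ K 0 α, γ ∈ wfPart (Stage m) := (mem_Stage.1 hα.1).2 m rfl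
  refine mem_wfPart_of_forall (mem_Stage.2 ⟨fun x hx => ?_, fun k hk γ hγ => ?_⟩)
    fun β hβ hlt => ?_
  · obtain ⟨γ, hγ, hx⟩ := mem_FC_theta_iff.1 hx
    exact (mem_Stage.1 (hKα γ hγ).1).1 x hx
  -- Level `0` occurs in `ϑα`, so its critical subterms are the critical subterms of those of `α`.
  · rw [K_theta_of_not_lt (h0.resolve_left (by omega))] at hγ
    obtain ⟨δ, hδ, hγ⟩ := (K_pred (by omega)).1 hγ
    exact (mem_Stage.1 (hKα δ hδ).1).2 k hk γ hγ
  · refine mem_Acc_of_summands fun g hg => ?_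
    replace hlt := hlt.forall_mem' g hg
    replace hβ := (mem_Stage_iff_summands β).1 hβ g hg
    clear hg
    -- Inner induction on the size of a summand of a predecessor, inside the outer induction along
    -- the accessible `α`.
    induction hn : g.size using Nat.strong_induction_on generalizing g with
    | _ n ihn =>
    subst hn
    rcases g.cases_on with ⟨γ, rfl⟩ | ⟨J, rfl⟩ | ⟨δ, rfl⟩
    · have hγ := hlt.of_omega_sc (isSC_theta α)
      refine omega_mem_Acc (mem_Acc_of_summands fun g hg => ?_)
      refine ihn g.size ?_ g (hγ.forall_mem' g hg)
        ((mem_Stage_iff_summands γ).1 (omega_mem_Stage.1 hβ) g hg) rfl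
      have := size_le_of_mem hg
      rw [size_omega]; omega
    · obtain ⟨γ, hγ, h⟩ := hlt.Omega_theta_inv
      by_cases e : {Omega J} = γ
      · rw [e]; exact hKα γ hγ
      · exact mem_wfPart_of_lt (hKα γ hγ) hβ (h e)
    · rcases hlt.theta_theta_inv with ⟨hδ, hK⟩ | ⟨γ, hγ, h⟩
      -- In the first case the critical subterms of `δ` lie below `ϑα` and are accessible by the
      -- inner induction; so `δ` belongs to stage `m + 1`, and the outer one applies as `δ < α`.
      -- Otherwise `ϑδ` has only negative levels.
      · by_cases hδ0 : m = 0 ∨ ¬ ∀ x ∈ FC 0 {theta δ}, x < 0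
        · have hKδ : ∀ γ ∈ K 0 δ, γ ∈ wfPart (Stage m) := fun γ hγ => by
            have hγS : γ ∈ Stage m := by
              refine mem_Stage.2 ⟨fun x hx => ?_, fun k hk ε hε => ?_⟩
              · exact (mem_Stage.1 hβ).1 x (mem_FC_theta_iff.2 ⟨γ, hγ, hx⟩)
              · refine (mem_Stage.1 hβ).2 k hk ε ?_
                rw [K_theta_of_not_lt (hδ0.resolve_left (by omega))]
                exact (K_pred (by omega)).2 ⟨γ, hγ, hε⟩
            refine mem_Acc_of_summands fun g hg => ?_
            refine ihn g.size ?_ g ((hK γ hγ).forall_mem' g hg)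
              ((mem_Stage_iff_summands γ).1 hγS g hg) rfl
            have := size_le_of_mem hg
            have := size_le_of_mem_K hγ
            rw [size_theta]; omega
          have hδS : δ ∈ Stage (m + 1) := by
            refine mem_Stage.2 ⟨fun x hx => ?_, fun k hk => ?_⟩
            · by_cases hx0 : x = 0
              · omega
              · have := nonpos_of_mem_FC hx
                have := (mem_Stage.1 hβ).1 (x + 1) (by
                  rw [FC_theta, mem_FC_iff_of_le (by omega : (0 : ℤ) - 1 ≤ 0)]
                  exact ⟨by omega, by simpa using hx⟩)
                push_cast; omega
            · obtain rfl : m = k := by omega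
              exact hKδ
          exact ih δ (mem_wfPart_of_lt hα hδS hδ) hδ hδ0
        · push Not at hδ0
          obtain ⟨m, rfl⟩ := Nat.exists_eq_succ_of_ne_zero hδ0.1
          exact mem_Acc_of_level_neg hβ hδ0.2
      · by_cases e : {theta δ} = γ
        · rw [e]; exact hKα γ hγ
        · exact mem_wfPart_of_lt (hKα γ hγ) hβ (h e)

/-! ### Accessibility of all terms -/

/-- For `J < 0` the only critical subterm is `Ω^(J+1)`, accessible one stage earlier. For `J = 0`
every predecessor has only negative levels. -/
theorem Omega_mem_Acc {m : ℕ} {J : Level} (hJ : -(m : ℤ) < J.1) :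
    {Omega J} ∈ wfPart (Stage m) := by
  induction m generalizing J with
  | zero => have := J.2; push_cast at hJ; omega
  | succ m ih =>
    have hS : {Omega J} ∈ Stage (m + 1) := by
      refine mem_Stage.2 ⟨fun x hx => ?_, fun k hk γ hγ => ?_⟩
      · simp [FC_Omega, J.2] at hx
        omega
      · obtain rfl : m = k := by omega
        rcases lt_or_ge J.1 0 with h | h
        · rw [K_Omega_of_lt h, Set.mem_singleton_iff] at hγ
          rw [hγ]
          exact ih (by push_cast at hJ; simp; omega)
        · rw [K_Omega_of_ge h] at hγ; exact hγ.elim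
    rcases lt_or_ge J.1 0 with h | h
    · refine mem_Acc_of_level_neg hS fun x hx => ?_
      simp [FC_Omega, J.2] at hx
      omega
    · refine mem_wfPart_of_forall hS fun β hβ hlt => mem_Acc_of_level_neg hβ fun x hx => ?_
      have := hlt.level_lt x hx
      have := J.2
      omega

/-- Every term is accessible. -/
theorem mem_Acc {m : ℕ} {α : OT} (hα : ∀ x ∈ FC 0 α, -(m : ℤ) < x) :
    α ∈ wfPart (Stage m) := by
  suffices ∀ n m : ℕ, ∀ g : H, g.size = n → (∀ x ∈ FC 0 {g}, -(m : ℤ) < x) →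
      {g} ∈ wfPart (Stage m) from
    mem_Acc_of_summands fun g hg => this _ m g rfl fun x hx => hα x (mem_FC.2 ⟨g, hg, hx⟩)
  -- Size is the outer induction because the argument of `ϑ` is smaller but needs stage `m + 1`; the
  -- shift up of a `ϑα` with negative levels keeps its size but moves to the previous stage.
  intro n
  induction n using Nat.strong_induction_on with
  | _ n ihn =>
  have hlt : ∀ (m : ℕ) (α : OT), size α < n → (∀ x ∈ FC 0 α, -(m : ℤ) < x) →
      α ∈ wfPart (Stage m) := fun m α hn hα => mem_Acc_of_summands fun g hg =>
    ihn g.size ((size_le_of_mem hg).trans_lt hn) m g rfl fun x hx => hα x (mem_FC.2 ⟨g, hg, hx⟩)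
  -- Level `0` of `α` is invisible in `ϑα`; every other level appears there raised by one.
  have hsucc : ∀ (m : ℕ) (α : OT), (∀ x ∈ FC 0 {theta α}, -(m : ℤ) < x) →
      ∀ x ∈ FC 0 α, -((m + 1 : ℕ) : ℤ) < x := fun m α hα x hx => by
    by_cases hx0 : x = 0
    · omega
    · have := nonpos_of_mem_FC hx
      have := hα (x + 1) (by
        rw [FC_theta, mem_FC_iff_of_le (by omega : (0 : ℤ) - 1 ≤ 0)]
        exact ⟨by omega, by simpa using hx⟩)
      push_cast; omega
  intro m
  induction m with
  | zero =>
    intro g hg hm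
    rcases g.cases_on with ⟨α, rfl⟩ | ⟨J, rfl⟩ | ⟨α, rfl⟩
    · rw [FC_omega] at hm
      exact omega_mem_Acc (hlt 0 α (by rw [← hg, size_omega]; omega) hm)
    · exact Omega_mem_Acc (hm J.1 (by simp [FC_Omega, J.2]))
    · exact theta_mem_Acc (hlt 1 α (by rw [← hg, size_theta]; omega) (hsucc 0 α hm)) (.inl rfl)
  | succ m ihm =>
    intro g hg hm
    rcases g.cases_on with ⟨α, rfl⟩ | ⟨J, rfl⟩ | ⟨α, rfl⟩
    · rw [FC_omega] at hm
      exact omega_mem_Acc (hlt _ α (by rw [← hg, size_omega]; omega) hm)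
    · exact Omega_mem_Acc (hm J.1 (by simp [FC_Omega, J.2]))
    · by_cases h0 : ∀ x ∈ FC 0 {theta α}, x < 0
      · refine mem_Acc_of_level_neg (mem_Stage.2 ⟨hm, fun k hk γ hγ => ?_⟩) h0
        obtain rfl : m = k := by omega
        rw [K_theta_of_lt h0, sub_zero, Set.mem_singleton_iff] at hγ
        have hs : Shiftable 0 1 {theta α} := fun x hx => by have := h0 x hx; omega
        have hsize : size γ = n := by rw [hγ, size_shift, size_singleton, hg]
        have hlev : ∀ x ∈ FC 0 γ, -(m : ℤ) < x := fun x hx => by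
          rw [hγ, mem_FC_shift_self le_rfl hs] at hx
          have := hm _ hx
          push_cast at this; omega
        rw [shift_singleton] at hγ
        subst hγ
        exact ihm _ (by rwa [size_singleton] at hsize) hlev
      · exact theta_mem_Acc (hlt _ α (by rw [← hg, size_theta]; omega) (hsucc _ α hm)) (.inr h0)
/-- The order is well-founded on the terms whose levels are bounded below. -/
theorem wellFounded_of_levels (m : ℕ) :
    WellFounded fun β γ : {α : OT // ∀ x ∈ FC 0 α, -(m : ℤ) < x} => Lt β.1 γ.1 := by
  have hS : ∀ α : OT, (∀ x ∈ FC 0 α, -(m : ℤ) < x) → α ∈ Stage m := fun α hα => (mem_Acc hα).1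
  refine ⟨fun α => Subrelation.accessible (fun {β γ} h => ?_) (InvImage.accessible
    (Subtype.val : {α : OT // ∀ x ∈ FC 0 α, -(m : ℤ) < x} → OT) (mem_Acc α.2).2)⟩
  exact ⟨hS β.1 β.2, hS γ.1 γ.2, h⟩

/-- Applied to `M_n`, whose levels are bounded below, this gives `Acc_n = M_n`. -/
theorem mem_wfPart_of_levels {m : ℕ} {S : Set OT} (hS : ∀ α ∈ S, ∀ x ∈ FC 0 α, -(m : ℤ) < x)
    {α : OT} (hα : α ∈ S) : α ∈ wfPart S := by
  refine ⟨hα, ?_⟩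
  have := (wellFounded_of_levels m).apply ⟨α, hS α hα⟩
  generalize hz : (⟨α, hS α hα⟩ : {α : OT // ∀ x ∈ FC 0 α, -(m : ℤ) < x}) = z at this
  induction this generalizing α with
  | intro z _ ih =>
    subst hz
    exact Acc.intro _ fun β hβ => ih ⟨β, hS β hβ.1⟩ hβ.2.2 hβ.1 rfl


/-! ### Grounds and normalization -/

theorem FCbar_eq_bot_iff {α : OT} : FCbar α = ⊥ ↔ FC 0 α = ∅ := Finset.max_eq_bot

theorem FCbar_eq_coe_iff {α : OT} {c : ℤ} :
    FCbar α = c ↔ c ∈ FC 0 α ∧ ∀ x ∈ FC 0 α, x ≤ c :=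
  ⟨fun h => ⟨Finset.mem_of_max h, fun _ hx => Finset.le_max_of_eq hx h⟩,
    fun h => le_antisymm (Finset.max_le fun x hx => WithBot.coe_le_coe.2 (h.2 x hx))
      (Finset.le_max h.1)⟩

theorem FCbar_eq_zero_iff {α : OT} : FCbar α = 0 ↔ 0 ∈ FC 0 α := by
  refine (FCbar_eq_coe_iff (c := 0)).trans ⟨fun h => h.1, fun h => ⟨h, fun x hx => ?_⟩⟩
  exact nonpos_of_mem_FC hx

theorem le_ground_iff {α : OT} {c : ℤ} :
    (c : WithBot ℤ) ≤ ground α ↔ (FC 0 α).Nonempty ∧ ∀ x ∈ FC 0 α, c ≤ x := by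
  unfold ground
  split_ifs with h
  · simp [h, WithBot.coe_le_coe, Finset.le_min'_iff]
  · simp [h]

theorem ground_eq_bot_iff {α : OT} : ground α = ⊥ ↔ FC 0 α = ∅ := by
  unfold ground
  split_ifs with h
  · simp [h.ne_empty]
  · simpa using Finset.not_nonempty_iff_eq_empty.1 h

theorem groundInt_of_empty {α : OT} (h : FC 0 α = ∅) : groundInt α = 0 := by
  simp [groundInt, ground_eq_bot_iff.2 h]

theorem groundInt_le {α : OT} {x : ℤ} (hx : x ∈ FC 0 α) : groundInt α ≤ x := by
  have h : (FC 0 α).Nonempty := ⟨x, hx⟩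
  simp only [groundInt, ground, dif_pos h, WithBot.unbotD_coe]
  exact Finset.min'_le _ _ hx

theorem groundInt_nonpos (α : OT) : groundInt α ≤ 0 := by
  rcases (FC 0 α).eq_empty_or_nonempty with h | ⟨x, hx⟩
  · rw [groundInt_of_empty h]
  · exact (groundInt_le hx).trans (nonpos_of_mem_FC hx)

theorem star_eq_self {α : OT} (h : FC 0 α = ∅) : star α = α := by
  rw [star, if_pos (FCbar_eq_bot_iff.2 h)]

theorem star_eq_shift {α : OT} (h : (FC 0 α).Nonempty) :
    ∃ c ∈ FC 0 α, (∀ x ∈ FC 0 α, x ≤ c) ∧ star α = shift 0 (-c) α := by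
  obtain ⟨c, hc⟩ := Finset.max_of_nonempty h
  have hc' : FCbar α = c := hc
  refine ⟨c, (FCbar_eq_coe_iff.1 hc').1, (FCbar_eq_coe_iff.1 hc').2, ?_⟩
  rw [star, if_neg (by simp [hc']), hc', WithBot.unbotD_coe]

/-- The levels of a normalized term: `0` occurs, if any does, and the levels have increased. -/
theorem levels_star (α : OT) : (FC 0 α = ∅ ∧ FC 0 (star α) = ∅) ∨
    (0 ∈ FC 0 (star α) ∧ ∀ x ∈ FC 0 (star α), ∃ y ∈ FC 0 α, y ≤ x) := by
  rcases (FC 0 α).eq_empty_or_nonempty with h | h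
  · exact .inl ⟨h, by rw [star_eq_self h, h]⟩
  · obtain ⟨c, hc, hmax, e⟩ := star_eq_shift h
    have hs : Shiftable 0 (-c) α := fun x hx => by have := hmax x hx; omega
    have := nonpos_of_mem_FC hc
    rw [e]
    refine .inr ⟨(mem_FC_shift_self le_rfl hs).2 (by simpa using hc), fun x hx => ?_⟩
    exact ⟨_, (mem_FC_shift_self le_rfl hs).1 hx, by omega⟩

theorem mem_AccSet_bot {α : OT} (h : FC 0 α = ∅) : α ∈ AccSet ⊥ := by
  rw [AccSet, M_bot]
  refine mem_wfPart_of_levels (m := 0) (fun β hβ x hx => ?_) (FCbar_eq_bot_iff.2 h)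
  rw [FCbar_eq_bot_iff.1 hβ] at hx
  simp at hx

/-- Only membership in `M_n` has content. A normalized critical subterm has no levels, or has levels
at least `-(n - 1)` and is covered by induction. -/
theorem mem_AccSet_coe {n : ℕ} {α : OT} (h0 : 0 ∈ FC 0 α) (hn : ∀ x ∈ FC 0 α, -(n : ℤ) ≤ x) :
    α ∈ AccSet n := by
  induction n using Nat.strong_induction_on generalizing α with
  | _ n ih =>
  have hM : α ∈ M n := by
    rw [M_coe]
    refine ⟨FCbar_eq_zero_iff.2 h0, le_ground_iff.2 ⟨⟨0, h0⟩, hn⟩, ?_⟩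
    rintro _ ⟨γ, hγ, rfl⟩
    simp only [Set.mem_iUnion]
    have hlev : ∀ x ∈ FC 0 γ, -(n : ℤ) + 1 ≤ x := fun x hx => by
      have h1 := (mem_FC_pred (J := 0) (by omega)).2 ⟨γ, hγ, hx⟩
      rw [mem_FC_iff_of_le (by omega : (0 : ℤ) - 1 ≤ 0)] at h1
      have := hn _ h1.2
      omega
    rcases levels_star γ with ⟨-, h⟩ | ⟨h, h'⟩
    · exact ⟨⊥, WithBot.bot_lt_coe n, mem_AccSet_bot h⟩
    -- Level `0` of the normalized subterm comes from a level at most `0` that is also at least `-n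
    -- + 1`.
    · have hn1 : 1 ≤ n := by
        obtain ⟨y, hy, hy0⟩ := h' 0 h
        have := hlev y hy
        omega
      refine ⟨((n - 1 : ℕ) : WithBot ℕ), ?_, ih (n - 1) (by omega) h fun x hx => ?_⟩
      · exact WithBot.coe_lt_coe.2 (Nat.sub_lt hn1 one_pos)
      · obtain ⟨y, hy, hyx⟩ := h' x hx
        have := hlev y hy
        omega
  refine mem_wfPart_of_levels (m := n + 1) (fun β hβ x hx => ?_) hM
  rw [M_coe] at hβ
  have := (le_ground_iff.1 hβ.2.1).2 x hx
  push_cast; omega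

/-! ### Comparison from the ground -/

/-- With `m` the common ground, the level `0` of a normalized `α` moves to `m - g(α)`, while no
level of the shifted `β` exceeds `m - g(β)`. Monotonicity in the levels gives the inequality. -/
theorem GroundLt.groundInt_le {α β : OT} (hα : α ∈ Set.range star) (h : GroundLt α β) :
    groundInt β ≤ groundInt α := by
  obtain ⟨α, rfl⟩ := hα
  rcases levels_star α with ⟨-, h0⟩ | ⟨h0, -⟩
  · rw [groundInt_of_empty h0]; exact groundInt_nonpos β
  · have h1 := h.level_le (c := min (groundInt (star α)) (groundInt β) - groundInt β)
      (fun x hx => by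
        rw [mem_FC_shift_self le_rfl (.of_nonpos (by omega) β)] at hx
        have := nonpos_of_mem_FC hx; omega)
      (min (groundInt (star α)) (groundInt β) - groundInt (star α))
      ((mem_FC_shift_self le_rfl (.of_nonpos (by omega) _)).2 (by simpa using h0))
    omega

/-- The comparison may be made at any ground `N` below both grounds, since shifting further down
preserves the order. -/
theorem GroundLt.shift {α β : OT} (h : GroundLt α β) {N : ℤ} (hα : N ≤ groundInt α)
    (hβ : N ≤ groundInt β) :
    Lt (shift 0 (N - groundInt α) α) (shift 0 (N - groundInt β) β) := by
  have h1 := Lt.shift h (J := 0) (n := N - min (groundInt α) (groundInt β)) le_rfl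
    (.of_nonpos (by omega) _) (.of_nonpos (by omega) _)
  rw [shift_shift le_rfl (.of_nonpos (by omega) _), shift_shift le_rfl (.of_nonpos (by omega) _)]
    at h1
  convert h1 using 2 <;> ring

theorem wellFoundedOn_GroundLt : (Set.range star).WellFoundedOn GroundLt := by
  -- Grounds do not decrease when descending, so a lower bound `-N` persists and all terms can be
  -- compared after moving their grounds to `-N`.
  have key : ∀ N : ℕ, ∀ α : Set.range star, -(N : ℤ) ≤ groundInt α.1 →
      Acc (fun a b : Set.range star => GroundLt a.1 b.1) α := by
    intro N α hα
    have hlev : ∀ α : OT, -(N : ℤ) ≤ groundInt α →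
        ∀ x ∈ FC 0 (PolyOT.shift 0 (-(N : ℤ) - groundInt α) α), -((N + 1 : ℕ) : ℤ) < x := by
      intro α hα x hx
      rw [mem_FC_shift_self le_rfl (.of_nonpos (by omega) α)] at hx
      have := groundInt_le hx
      push_cast; omega
    have hacc := (wellFounded_of_levels (N + 1)).apply ⟨_, hlev α.1 hα⟩
    generalize hz : (⟨_, hlev α.1 hα⟩ :
      {α : OT // ∀ x ∈ FC 0 α, -((N + 1 : ℕ) : ℤ) < x}) = z at hacc
    induction hacc generalizing α with
    | intro z _ ih =>
      subst hz
      refine Acc.intro _ fun β hβ => ?_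
      have hβN : -(N : ℤ) ≤ groundInt β.1 := hα.trans (GroundLt.groundInt_le β.2 hβ)
      exact ih ⟨_, hlev β.1 hβN⟩ (GroundLt.shift hβ hβN hα) β hβN rfl
  refine ⟨fun α => ?_⟩
  have := groundInt_nonpos α.1
  exact key (-(groundInt α.1)).toNat α (by omega)

end PolyOT

theorem mainTheorem1 :
    (∀ α : PolyOT.OT, PolyOT.ground (PolyOT.star α) = ⊥ →
      PolyOT.star α ∈ PolyOT.AccSet ⊥) ∧
    (∀ (α : PolyOT.OT) (n : ℕ),
      ((-(n : ℤ) : ℤ) : WithBot ℤ) ≤ PolyOT.ground (PolyOT.star α) →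
      PolyOT.star α ∈ PolyOT.AccSet (n : WithBot ℕ)) ∧
    (Set.range PolyOT.star).WellFoundedOn PolyOT.GroundLt := by
  refine ⟨fun α h => PolyOT.mem_AccSet_bot (PolyOT.ground_eq_bot_iff.1 h), fun α n h => ?_,
    PolyOT.wellFoundedOn_GroundLt⟩
  obtain ⟨hne, hn⟩ := PolyOT.le_ground_iff.1 h
  rcases PolyOT.levels_star α with ⟨-, h0⟩ | ⟨h0, -⟩
  -- An integer lower bound on the ground rules out `-∞`.
  · simp [h0] at hne
  · exact PolyOT.mem_AccSet_coe h0 hn
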